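/- **Setting.** Let $\Omega_S,\Omega_D\subset\mathbb R^2$ be disjoint bounded simply connected polygonal domains (open sets, lying on one side of a boundary made of finitely many segments) with $\Gamma:=\partial\Omega_S\cap\partial\Omega_D\neq\emptyset$, and put $\Gamma_S=\partial\Omega_S\setminus\Gamma$, $\Gamma_D=\partial\Omega_D\setminus\Gamma$. Let $\mathbf n$ be the unit normal on $\Gamma$ pointing from $\Omega_S$ to $\Omega_D$ (defined off finitely many points) and $\mathbf t$ the unit tangent. Let $\mu,\rho,\beta,\nu,G>0$ be constants and let $\mathbf K$ be a measurable, bounded, uniformly positive definite $2\times2$ matrix field on $\Omega_D$. Let $\omega_1$ on $\Omega_S\cup\Omega_D$, $\omega_2$ on $\Gamma_S\cup\Gamma_D$ and $\omega_3$ on $\Gamma$ be nonnegative integrable densities (for example probability densities), with respect to area for $\omega_1$ and arc length for $\omega_2,\omega_3$. Let $\mathbf f_S,\mathbf g_D$ be vector-valued sources and $f_D$ a scalar source. Write $\|f\|^2_{Y,\omega}=\int_Y|f|^2\,\omega$. The loss of $\bar{\mathbf U}=(\mathbf U_S,\mathbf U_D,P_S,P_D)$ is $$\begin{aligned}J(\bar{\mathbf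 U})={}&\|\mathbf f_S+\nu\Delta\mathbf U_S-\nabla P_S\|^2_{\Omega_S,\omega_1}+\|\nabla\cdot\mathbf U_S\|^2_{\Omega_S,\omega_1}+\|\mathbf U_S\|^2_{\Gamma_S,\omega_2}\\&+\|f_D-\nabla\cdot\mathbf U_D\|^2_{\Omega_D,\omega_1}+\big\|\tfrac\mu\rho\mathbf K^{-1}\mathbf U_D+\tfrac\beta\rho|\mathbf U_D|\mathbf U_D+\nabla P_D-\mathbf g_D\big\|^2_{\Omega_D,\omega_1}+\|P_D\|^2_{\Gamma_D,\omega_2}\\&+\|\mathbf U_S\cdot\mathbf n-\mathbf U_D\cdot\mathbf n\|^2_{\Gamma,\omega_3}+\big\|P_S-\nu\,\mathbf n\cdot\tfrac{\partial\mathbf U_S}{\partial\mathbf n}-P_D\big\|^2_{\Gamma,\omega_3}+\big\|-\nu\,\mathbf t\cdot\tfrac{\partial\mathbf U_S}{\partial\mathbf n}-G\,\mathbf U_S\cdot\mathbf t\big\|^2_{\Gamma,\omega_3}.\end{aligned}$$ For $\sigma:\mathbb R\to\mathbb R$ let $\mathfrak C(\sigma)$ be the set of functions $x\mapsto\sum_{i=1}^m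 b_i\,\sigma(a_i\cdot x+c_i)$ on $\mathbb R^2$ with $m\in\mathbb N$, $b_i,c_i\in\mathbb R$, $a_i\in\mathbb R^2$, and let $[\mathfrak C(\sigma)]^2$ be the set of vector fields both of whose components lie in $\mathfrak C(\sigma)$. **Theorem 3.1.** For all such $\Omega_S,\Omega_D,\mu,\rho,\beta,\mathbf K,\omega_1,\omega_2,\omega_3,f_D,\mathbf g_D,\mathbf f_S$ there is a constant $C>0$, depending on these data only, with the following property. Let $\nu,G>0$, let $\varphi,\zeta,\psi,\gamma\in C^2(\mathbb R)$ be bounded and non-constant, and suppose that the coupled problem $$-\nu\Delta\mathbf u_S+\nabla p_S=\mathbf f_S,\quad\nabla\cdot\mathbf u_S=0\ \text{ in }\Omega_S,\qquad\mathbf u_S=0\ \text{ on }\Gamma_S,$$ $$\nabla\cdot\mathbf u_D=f_D,\quad\tfrac\mu\rho\mathbf K^{-1}\mathbf u_D+\tfrac\beta\rho|\mathbf u_D|\mathbf u_D+\nabla p_D=\mathbf g_D\ \text{ in }\Omega_D,\qquad p_D=0\ \text{ on }\Gamma_D,$$ $$\mathbf u_S\cdot\mathbf n=\mathbf u_D\cdot\mathbf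 n,\quad p_S-\nu\,\mathbf n\cdot\tfrac{\partial\mathbf u_S}{\partial\mathbf n}=p_D,\quad-\nu\,\mathbf t\cdot\tfrac{\partial\mathbf u_S}{\partial\mathbf n}=G\,\mathbf u_S\cdot\mathbf t\ \text{ on }\Gamma$$ has an exact solution $(\mathbf u_S,\mathbf u_D,p_S,p_D)\in C^2(\bar\Omega_S)^2\times C^2(\bar\Omega_D)^2\times C^1(\bar\Omega_S)\times C^1(\bar\Omega_D)$, where $C^k(\bar\Omega)$ consists of the restrictions to $\bar\Omega$ of $C^k$ functions on $\mathbb R^2$. Then for every $\varepsilon>0$ there is $$\bar{\mathbf U}=(\mathbf U_S,\mathbf U_D,P_S,P_D)\in[\mathfrak C(\varphi)]^2\times[\mathfrak C(\zeta)]^2\times\mathfrak C(\psi)\times\mathfrak C(\gamma)\quad\text{with}\quad J(\bar{\mathbf U})\le C\varepsilon^2.$$ -/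

import Mathlib

open MeasureTheory
open scoped ENNReal

noncomputable section

namespace CDNN

/-- The Euclidean plane. -/
abbrev Plane : Type := EuclideanSpace ℝ (Fin 2)

/-! ### Geometry -/

/-- A bounded, simply connected polygonal domain of the plane: an open set whose boundary is a finite
union of line segments and which lies locally on one side of its boundary (no slits and no
punctures: `Ω` is the interior of its closure). Simple connectedness includes that `Ω` is nonempty
and connected. -/
structure IsPolygonalDomain (Ω : Set Plane) : Prop where
  isOpen : IsOpen Ω
  bounded : Bornology.IsBounded Ω
  simplyConnected : SimplyConnectedSpace Ω
  interior_closure : interior (closure Ω) = Ω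
  polygonal : ∃ (N : ℕ) (a b : Fin N → Plane), frontier Ω = ⋃ i, segment ℝ (a i) (b i)

/-- `n` is the outer unit normal of `Ω` at `x`: near `x`, the set `Ω` is the open half plane
`{y | ⟪n, y - x⟫ < 0}`. For a polygonal domain this singles out the normal at every boundary point
that is not a vertex. -/
def IsOuterUnitNormal (Ω : Set Plane) (x n : Plane) : Prop :=
  ‖n‖ = 1 ∧ ∃ r > 0, ∀ y ∈ Metric.ball x r, y ∈ Ω ↔ inner ℝ n (y - x) < 0

/-- The outer unit normal is unique where it exists. -/
theorem IsOuterUnitNormal.unique {Ω : Set Plane} {x n n' : Plane}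
    (h : IsOuterUnitNormal Ω x n) (h' : IsOuterUnitNormal Ω x n') : n = n' := by
  obtain ⟨hn, r, hr, H⟩ := h
  obtain ⟨hn', r', hr', H'⟩ := h'
  by_contra hne
  have hlt : inner ℝ n n' < 1 := by
    refine lt_of_le_of_ne ?_ ?_
    · simpa [hn, hn'] using real_inner_le_norm n n'
    · intro h1
      exact hne ((inner_eq_one_iff_of_norm_eq_one hn hn').1 h1)
  have hpos : 0 < ‖n' - n‖ := norm_pos_iff.2 (sub_ne_zero.2 (Ne.symm hne))
  set t : ℝ := (min r r' / 2) / ‖n' - n‖ with ht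
  have hm : 0 < min r r' := lt_min hr hr'
  have htpos : 0 < t := by positivity
  have hnorm : ‖t • (n' - n)‖ = min r r' / 2 := by
    rw [norm_smul, Real.norm_of_nonneg htpos.le, ht]
    field_simp
  have hb : x + t • (n' - n) ∈ Metric.ball x r := by
    rw [Metric.mem_ball, dist_eq_norm, add_sub_cancel_left, hnorm]
    linarith [min_le_left r r']
  have hb' : x + t • (n' - n) ∈ Metric.ball x r' := by
    rw [Metric.mem_ball, dist_eq_norm, add_sub_cancel_left, hnorm]
    linarith [min_le_right r r']
  have e1 : inner ℝ n (n' - n) < 0 := by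
    rw [inner_sub_right, real_inner_self_eq_norm_sq, hn]; linarith
  have e2 : 0 < inner ℝ n' (n' - n) := by
    rw [inner_sub_right, real_inner_self_eq_norm_sq, hn', real_inner_comm]; linarith
  have k1 : x + t • (n' - n) ∈ Ω := by
    rw [H _ hb, add_sub_cancel_left, inner_smul_right]
    exact mul_neg_of_pos_of_neg htpos e1
  have k2 := (H' _ hb').1 k1
  rw [add_sub_cancel_left, inner_smul_right] at k2
  linarith [mul_pos htpos e2]

open Classical in
/-- The outer unit normal field of `Ω`, with the value `0` where there is no normal
(on the boundary of a polygonal domain: only at finitely many points). -/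
def outerNormal (Ω : Set Plane) (x : Plane) : Plane :=
  if h : ∃ n, IsOuterUnitNormal Ω x n then h.choose else 0

theorem outerNormal_eq {Ω : Set Plane} {x n : Plane} (h : IsOuterUnitNormal Ω x n) :
    outerNormal Ω x = n := by
  have hex : ∃ n, IsOuterUnitNormal Ω x n := ⟨n, h⟩
  rw [outerNormal, dif_pos hex]
  exact hex.choose_spec.unique h

/-- The rotation by a right angle; it turns a unit normal into a unit tangent. -/
def rot (n : Plane) : Plane := !₂[-n 1, n 0]

/-! ### Differential operators and coefficients -/

/-- The divergence `∑ i, ∂ᵢ vᵢ` of a vector field. -/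
def divergence (v : Plane → Plane) (x : Plane) : ℝ :=
  ∑ i : Fin 2, (fderiv ℝ v x (EuclideanSpace.single i 1)) i

/-- A matrix applied to a vector of the plane. -/
def matVec (A : Matrix (Fin 2) (Fin 2) ℝ) (v : Plane) : Plane :=
  WithLp.toLp 2 (A.mulVec v)

/-- The data of the coupled problem apart from the Stokes viscosity `ν` and the interface
constant `G`: the two polygonal domains, the Darcy-Forchheimer coefficients, the sampling densities
and the sources. The density `ω₁` lives on the two domains, `ω₂` on the two outer boundaries and
`ω₃` on the interface; the measure on boundary pieces is arc length, that is, one-dimensional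
Hausdorff measure. Of the densities only nonnegativity and finite total mass are asked, which
contains every normalisation to a probability density. -/
structure Data where
  /-- The Stokes domain. -/
  ΩS : Set Plane
  /-- The Darcy-Forchheimer domain. -/
  ΩD : Set Plane
  polygonalS : IsPolygonalDomain ΩS
  polygonalD : IsPolygonalDomain ΩD
  disjoint : Disjoint ΩS ΩD
  interface_nonempty : (frontier ΩS ∩ frontier ΩD).Nonempty
  μ : ℝ
  ρ : ℝ
  β : ℝ
  μ_pos : 0 < μ
  ρ_pos : 0 < ρ
  β_pos : 0 < β
  /-- The permeability tensor. -/
  K : Plane → Matrix (Fin 2) (Fin 2) ℝ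
  K_measurable : ∀ i j, AEMeasurable (fun x => K x i j) (volume.restrict ΩD)
  K_bounded : ∃ k₁ : ℝ, ∀ x ∈ ΩD, ∀ ξ : Plane, ‖matVec (K x) ξ‖ ≤ k₁ * ‖ξ‖
  K_posDef : ∃ k₀ : ℝ, 0 < k₀ ∧ ∀ x ∈ ΩD, ∀ ξ : Plane, k₀ * ‖ξ‖ ^ 2 ≤ inner ℝ ξ (matVec (K x) ξ)
  ω₁ : Plane → ℝ
  ω₂ : Plane → ℝ
  ω₃ : Plane → ℝ
  ω₁_nonneg : ∀ x ∈ ΩS ∪ ΩD, 0 ≤ ω₁ x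
  ω₁_integrable : IntegrableOn ω₁ (ΩS ∪ ΩD) volume
  ω₂_nonneg : ∀ x ∈ (frontier ΩS ∪ frontier ΩD) \ (frontier ΩS ∩ frontier ΩD), 0 ≤ ω₂ x
  ω₂_integrable :
    IntegrableOn ω₂ ((frontier ΩS ∪ frontier ΩD) \ (frontier ΩS ∩ frontier ΩD)) μH[1]
  ω₃_nonneg : ∀ x ∈ frontier ΩS ∩ frontier ΩD, 0 ≤ ω₃ x
  ω₃_integrable : IntegrableOn ω₃ (frontier ΩS ∩ frontier ΩD) μH[1]
  /-- The Stokes source. -/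
  fS : Plane → Plane
  /-- The scalar Darcy source. -/
  fD : Plane → ℝ
  /-- The vectorial Darcy-Forchheimer source. -/
  gD : Plane → Plane

namespace Data

variable (D : Data)

/-- The interface. -/
def Γ : Set Plane := frontier D.ΩS ∩ frontier D.ΩD

/-- The outer boundary of the Stokes domain. -/
def ΓS : Set Plane := frontier D.ΩS \ D.Γ

/-- The outer boundary of the Darcy domain. -/
def ΓD : Set Plane := frontier D.ΩD \ D.Γ

/-- The unit normal on the interface that points from the Stokes to the Darcy domain. -/
def nS : Plane → Plane := outerNormal D.ΩS

/-- The unit tangent on the interface. -/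
def tS (x : Plane) : Plane := rot (D.nS x)

/-! ### Residuals -/

/-- The residual of the Stokes momentum equation. -/
def stokesRes (ν : ℝ) (U : Plane → Plane) (P : Plane → ℝ) (x : Plane) : Plane :=
  D.fS x + ν • Laplacian.laplacian U x - gradient P x

/-- The residual of the Darcy-Forchheimer law. -/
def darcyRes (U : Plane → Plane) (P : Plane → ℝ) (x : Plane) : Plane :=
  (D.μ / D.ρ) • matVec (D.K x)⁻¹ (U x) + (D.β / D.ρ) • (‖U x‖ • U x) + gradient P x - D.gD x

/-- The residual of the continuity of the normal velocity, with normal `n`. -/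
def normalVelRes (US UD : Plane → Plane) (n x : Plane) : ℝ :=
  inner ℝ (US x) n - inner ℝ (UD x) n

/-- The residual of the balance of normal forces, with normal `n`. -/
def normalForceRes (ν : ℝ) (US : Plane → Plane) (PS PD : Plane → ℝ) (n x : Plane) : ℝ :=
  PS x - ν * inner ℝ n (fderiv ℝ US x n) - PD x

/-- The residual of the Beavers-Joseph-Saffman condition, with normal `n` and tangent `t`. -/
def bjsRes (ν G : ℝ) (US : Plane → Plane) (n t x : Plane) : ℝ :=
  -ν * inner ℝ t (fderiv ℝ US x n) - G * inner ℝ (US x) t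

end Data

/-- `∫_Y |f|² ω dm`, as an extended nonnegative number (so that it is infinite, and not `0`, if
`|f|² ω` is not integrable). -/
def sqNorm {F : Type*} [NormedAddCommGroup F] (m : Measure Plane) (Y : Set Plane) (ω : Plane → ℝ)
    (f : Plane → F) : ℝ≥0∞ :=
  ∫⁻ x in Y, ENNReal.ofReal (‖f x‖ ^ 2 * ω x) ∂m

namespace Data

variable (D : Data)

/-- The part of the loss on the Stokes side. -/
def lossS (ν : ℝ) (US : Plane → Plane) (PS : Plane → ℝ) : ℝ≥0∞ :=
  sqNorm volume D.ΩS D.ω₁ (D.stokesRes ν US PS)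
    + sqNorm volume D.ΩS D.ω₁ (divergence US)
    + sqNorm μH[1] D.ΓS D.ω₂ US

/-- The part of the loss on the Darcy side. -/
def lossD (UD : Plane → Plane) (PD : Plane → ℝ) : ℝ≥0∞ :=
  sqNorm volume D.ΩD D.ω₁ (fun x => D.fD x - divergence UD x)
    + sqNorm volume D.ΩD D.ω₁ (D.darcyRes UD PD)
    + sqNorm μH[1] D.ΓD D.ω₂ PD

/-- The part of the loss on the interface. -/
def lossΓ (ν G : ℝ) (US UD : Plane → Plane) (PS PD : Plane → ℝ) : ℝ≥0∞ :=
  sqNorm μH[1] D.Γ D.ω₃ (fun x => normalVelRes US UD (D.nS x) x)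
    + sqNorm μH[1] D.Γ D.ω₃ (fun x => normalForceRes ν US PS PD (D.nS x) x)
    + sqNorm μH[1] D.Γ D.ω₃ (fun x => bjsRes ν G US (D.nS x) (D.tS x) x)

/-- The total loss `J` of `(US, UD, PS, PD)`. -/
def loss (ν G : ℝ) (US UD : Plane → Plane) (PS PD : Plane → ℝ) : ℝ≥0∞ :=
  D.lossS ν US PS + D.lossD UD PD + D.lossΓ ν G US UD PS PD

/-- `(uS, uD, pS, pD)` is an exact classical solution of the coupled problem of class `C²` (the
velocities) and `C¹` (the pressures) up to the boundary. A function is of class `Cᵏ` on the closure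
of a polygonal domain if it is the restriction of a `Cᵏ` function on the plane, and the four functions
are such extensions; nothing is asked of them away from the closures of the two domains. The
interface conditions are asked at the points of the interface that have a normal. -/
structure IsClassicalSolution (ν G : ℝ) (uS uD : Plane → Plane) (pS pD : Plane → ℝ) : Prop where
  contDiff_uS : ContDiff ℝ 2 uS
  contDiff_uD : ContDiff ℝ 2 uD
  contDiff_pS : ContDiff ℝ 1 pS
  contDiff_pD : ContDiff ℝ 1 pD
  darcy_mass : ∀ x ∈ D.ΩD, divergence uD x = D.fD x
  darcy_law : ∀ x ∈ D.ΩD,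
    (D.μ / D.ρ) • matVec (D.K x)⁻¹ (uD x) + (D.β / D.ρ) • (‖uD x‖ • uD x) + gradient pD x = D.gD x
  darcy_boundary : ∀ x ∈ D.ΓD, pD x = 0
  stokes_momentum : ∀ x ∈ D.ΩS, -(ν • Laplacian.laplacian uS x) + gradient pS x = D.fS x
  stokes_mass : ∀ x ∈ D.ΩS, divergence uS x = 0
  stokes_boundary : ∀ x ∈ D.ΓS, uS x = 0
  normal_velocity : ∀ x ∈ D.Γ, ∀ n, IsOuterUnitNormal D.ΩS x n →
    inner ℝ (uS x) n = inner ℝ (uD x) n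
  normal_force : ∀ x ∈ D.Γ, ∀ n, IsOuterUnitNormal D.ΩS x n →
    pS x - ν * inner ℝ n (fderiv ℝ uS x n) = pD x
  beavers_joseph_saffman : ∀ x ∈ D.Γ, ∀ n, IsOuterUnitNormal D.ΩS x n →
    -ν * inner ℝ (rot n) (fderiv ℝ uS x n) = G * inner ℝ (uS x) (rot n)

end Data

/-! ### Networks -/

/-- An admissible activation function: of class `C²`, bounded and not constant. -/
structure IsActivation (φ : ℝ → ℝ) : Prop where
  contDiff : ContDiff ℝ 2 φ
  bounded : ∃ M : ℝ, ∀ s, |φ s| ≤ M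
  nonconstant : ¬ ∃ c : ℝ, ∀ s, φ s = c

/-- The scalar networks with one hidden layer of `m` units and activation `φ`. -/
def scalarNet (φ : ℝ → ℝ) (m : ℕ) : Set (Plane → ℝ) :=
  {f | ∃ (β c : Fin m → ℝ) (σ : Fin 2 → Fin m → ℝ),
    ∀ x, f x = ∑ i, β i * φ (∑ j, σ j i * x j + c i)}

/-- The scalar networks with one hidden layer of arbitrarily many units. -/
def scalarNets (φ : ℝ → ℝ) : Set (Plane → ℝ) := ⋃ m, scalarNet φ m

/-- The vector-valued networks with one hidden layer of arbitrarily many units: the components share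
the activation function and the number of units, and each has its own weights and thresholds. -/
def vectorNets (φ : ℝ → ℝ) : Set (Plane → Plane) :=
  ⋃ m, {Θ | ∀ k : Fin 2, (fun x => Θ x k) ∈ scalarNet φ m}

end CDNN

end

/-! The infimum of the loss over networks is `0`, so the constant `C = 1` serves. All nine residuals
are continuous in the fields and their derivatives, of second order for the velocities and of first
order for the pressures, so networks that are uniformly close to an exact solution, together with
these derivatives, have uniformly small residuals (`CDNN.Data.exists_loss_le`), and the squared
norms are taken against densities of finite mass. Two matters need an argument.

*The interface.* The normal is replaced by `0` where it does not exist, and there the residuals need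
not be small. The points without a normal are among the end points of the boundary segments and the
points in which two of them cross, a finite set
(`CDNN.IsPolygonalDomain.exists_finite_isOuterUnitNormal`), which has no length.

*Density of networks in `Cⁿ`, `n ≤ 2`* (`CDNN.IsActivation.isApprox`). Mollifying a compactly
supported `f` with a kernel `k`, and replacing `k` by a uniformly close sum `p` of exponentials
`exp ⟪a, x⟫`, one obtains a function `p ⋆ f` close to `f` in `Cⁿ`, because all derivatives can be put
on `f`. Since exponentials are characters, `p ⋆ f` is itself a sum of exponentials
(`CDNN.isApprox_expSums`). This reduces the claim to the approximation of `exp` in `C²([-S, S])` by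
one-dimensional networks `∑ bᵢ φ (aᵢ s + cᵢ)` (`CDNN.IsActivation.exists_lineNets_exp`). Up to affine
functions, which are limits of difference quotients of `φ`, this is the uniform density of the
combinations of `φ'' (a s + c)`, `a ≠ 0` (`CDNN.IsActivation.dense_span_dilate`). If a functional
annihilates these functions, it annihilates the dilates of a smooth mollification `T` of `φ''`, and
differentiation in `a` at `a = 0` shows that it annihilates `T⁽ᵏ⁾(c) sᵏ` for all `k` and `c`. For a
suitable mollifier no derivative of `T` vanishes identically, since otherwise `φ` would be a limit of
bounded polynomials, that is, of constants. So the functional annihilates all polynomials and is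
zero. -/

noncomputable section

namespace CDNN

open scoped Convolution ContDiff
open Filter Topology

/-! ### Normals of polygonal domains -/

/-- If, near a boundary point `x`, the frontier of `Ω` is a straight line, and `Ω` is the interior of
its closure, then `Ω` fills exactly one of the two half discs, so it has a normal at `x`. -/
theorem exists_isOuterUnitNormal_of_frontier_eq_line {Ω : Set Plane} (ho : IsOpen Ω)
    (hi : interior (closure Ω) = Ω) {x n : Plane} (hx : x ∈ frontier Ω) (hn : ‖n‖ = 1)
    {r : ℝ} (hr : 0 < r)
    (hline : ∀ y ∈ Metric.ball x r, y ∈ frontier Ω ↔ inner ℝ n (y - x) = 0) :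
    ∃ m, IsOuterUnitNormal Ω x m := by
  -- A half disc is connected and misses the frontier.
  have half : ∀ m : Plane, (m = n ∨ m = -n) →
      (∀ y ∈ Metric.ball x r, inner ℝ m (y - x) < 0 → y ∈ Ω) ∨
      (∀ y ∈ Metric.ball x r, inner ℝ m (y - x) < 0 → y ∉ closure Ω) := by
    intro m hm
    set H : Set Plane := Metric.ball x r ∩ {y | inner ℝ m (y - x) < 0} with hH
    have hconv : Convex ℝ H := by
      refine (convex_ball x r).inter ?_
      have : {y : Plane | inner ℝ m (y - x) < 0} = {y : Plane | inner ℝ m y < inner ℝ m x} := by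
        ext y; simp [inner_sub_right]
      rw [this]
      exact convex_halfSpace_lt (IsLinearMap.mk (fun a b => inner_add_right _ _ _)
        (fun c a => by simp [inner_smul_right])) _
    have hfr : Disjoint H (frontier Ω) := by
      rw [Set.disjoint_left]
      rintro y ⟨hy, hy'⟩ hyf
      have := (hline y hy).1 hyf
      rcases hm with rfl | rfl
      · exact absurd this (ne_of_lt hy')
      · have h2 : inner ℝ (-n) (y - x) < 0 := hy'
        rw [inner_neg_left, this] at h2
        simp at h2
    by_cases hne : (H ∩ Ω).Nonempty
    · left
      have hsub : H ⊆ Ω :=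
        hconv.isPreconnected.subset_of_closure_inter_subset ho hne fun y hy => by
          by_contra hyo
          exact Set.disjoint_left.1 hfr hy.2 ⟨hy.1, by rwa [ho.interior_eq]⟩
      exact fun y hy hy' => hsub ⟨hy, hy'⟩
    · right
      intro y hy hy' hyc
      by_cases hyo : y ∈ Ω
      · exact hne ⟨y, ⟨hy, hy'⟩, hyo⟩
      · exact Set.disjoint_left.1 hfr ⟨hy, hy'⟩ ⟨hyc, by rwa [ho.interior_eq]⟩
  have hline' : ∀ y ∈ Metric.ball x r, inner ℝ n (y - x) = 0 → y ∉ Ω := by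
    intro y hy h0 hyo
    have := ((hline y hy).2 h0).2
    rw [ho.interior_eq] at this
    exact this hyo
  rcases half n (Or.inl rfl) with h1 | h1 <;> rcases half (-n) (Or.inr rfl) with h2 | h2
  · -- `Ω` on both sides would make `x` an interior point of the closure.
    exfalso
    have : Metric.ball x r ⊆ closure Ω := by
      intro y hy
      rcases lt_trichotomy (inner ℝ n (y - x)) 0 with h | h | h
      · exact subset_closure (h1 y hy h)
      · exact ((hline y hy).2 h).1
      · exact subset_closure (h2 y hy (by rw [inner_neg_left]; linarith))
    have hxi : x ∈ interior (closure Ω) :=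
      interior_mono this (by rw [Metric.isOpen_ball.interior_eq]; exact Metric.mem_ball_self hr)
    rw [hi] at hxi
    exact hx.2 (by rwa [ho.interior_eq])
  · refine ⟨n, hn, r, hr, fun y hy => ⟨fun hyo => ?_, fun h => h1 y hy h⟩⟩
    rcases lt_trichotomy (inner ℝ n (y - x)) 0 with h | h | h
    · exact h
    · exact absurd hyo (hline' y hy h)
    · exact absurd (subset_closure hyo) (h2 y hy (by rw [inner_neg_left]; linarith))
  · refine ⟨-n, by rwa [norm_neg], r, hr, fun y hy => ⟨fun hyo => ?_, fun h => h2 y hy h⟩⟩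
    rw [inner_neg_left]
    rcases lt_trichotomy (inner ℝ n (y - x)) 0 with h | h | h
    · exact absurd (subset_closure hyo) (h1 y hy h)
    · exact absurd hyo (hline' y hy h)
    · linarith
  · -- `Ω` on neither side would leave `x` outside the closure.
    exfalso
    obtain ⟨y, hyb, hyo⟩ := mem_closure_iff.1 hx.1 _ Metric.isOpen_ball (Metric.mem_ball_self hr)
    rcases lt_trichotomy (inner ℝ n (y - x)) 0 with h | h | h
    · exact h1 y hyb h (subset_closure hyo)
    · exact hline' y hyb h hyo
    · exact h2 y hyb (by rw [inner_neg_left]; linarith) (subset_closure hyo)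

theorem inner_rot_self (v : Plane) : inner ℝ (rot v) v = 0 := by
  simp [rot, PiLp.inner_apply, Fin.sum_univ_two]; ring

theorem norm_rot (v : Plane) : ‖rot v‖ = ‖v‖ := by
  simp [rot, EuclideanSpace.norm_eq, Fin.sum_univ_two, add_comm]

/-- In the plane, the line orthogonal to `rot v` is spanned by `v`. -/
theorem exists_smul_eq_of_inner_rot_eq_zero {v w : Plane} (hv : v ≠ 0)
    (h : inner ℝ (rot v) w = 0) : ∃ s : ℝ, w = s • v := by
  have h' : -v 1 * w 0 + v 0 * w 1 = 0 := by
    simpa [rot, PiLp.inner_apply, Fin.sum_univ_two, mul_comm] using h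
  have hne : v 0 ≠ 0 ∨ v 1 ≠ 0 := by
    by_contra! hc
    exact hv (by ext i; fin_cases i <;> simp [hc.1, hc.2])
  rcases hne with h0 | h1
  · refine ⟨w 0 / v 0, ?_⟩
    ext i; fin_cases i
    · simp [h0]
    · simp; field_simp; linarith
  · refine ⟨w 1 / v 1, ?_⟩
    ext i; fin_cases i
    · simp; field_simp; linarith
    · simp [h1]

/-- A relatively inner point of a segment has a neighbourhood in which the supporting line stays in
the segment. -/
theorem exists_pos_forall_add_smul_mem_segment {a b x : Plane} (hx : x ∈ segment ℝ a b)
    (hxa : x ≠ a) (hxb : x ≠ b) :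
    ∃ δ > 0, ∀ s : ℝ, |s| < δ → x + s • (b - a) ∈ segment ℝ a b := by
  rw [segment_eq_image'] at hx
  obtain ⟨t, ⟨ht0, ht1⟩, rfl⟩ := hx
  have ht0' : 0 < t := lt_of_le_of_ne ht0 (by rintro rfl; simp at hxa)
  have ht1' : t < 1 := lt_of_le_of_ne ht1 (by rintro rfl; simp at hxb)
  refine ⟨min t (1 - t), lt_min ht0' (by linarith), fun s hs => ?_⟩
  rw [segment_eq_image']
  have h1 := hs.trans_le (min_le_left _ _)
  have h2 := hs.trans_le (min_le_right _ _)
  rw [abs_lt] at h1 h2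
  exact ⟨t + s, ⟨by linarith, by linarith⟩, by simp only []; module⟩

/-- Two points of a line span its direction. -/
theorem inner_rot_sub_eq_zero_of_mem_segment {a b x y z v : Plane} (hx : x ∈ segment ℝ a b)
    (hy : y ∈ segment ℝ a b) (hz : z ∈ segment ℝ a b) (hne : y ≠ x)
    (h : inner ℝ (rot v) (y - x) = 0) : inner ℝ (rot v) (z - x) = 0 := by
  rw [segment_eq_image'] at hx hy hz
  obtain ⟨t, -, rfl⟩ := hx
  obtain ⟨s, -, rfl⟩ := hy
  obtain ⟨u, -, rfl⟩ := hz
  have e1 : a + s • (b - a) - (a + t • (b - a)) = (s - t) • (b - a) := by module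
  have e2 : a + u • (b - a) - (a + t • (b - a)) = (u - t) • (b - a) := by module
  have hst : s - t ≠ 0 := by
    intro h0
    apply hne
    rw [sub_eq_zero.1 h0]
  simp only [e1, e2, inner_smul_right] at h ⊢
  rcases mul_eq_zero.1 h with h | h
  · exact absurd h hst
  · rw [h, mul_zero]

/-- The exceptional set consists of the end points of the segments and of the points in which two of
the segments cross. -/
theorem IsPolygonalDomain.exists_finite_isOuterUnitNormal {Ω : Set Plane}
    (h : IsPolygonalDomain Ω) :
    ∃ S : Set Plane, S.Finite ∧ ∀ x ∈ frontier Ω, x ∉ S → ∃ n, IsOuterUnitNormal Ω x n := by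
  classical
  obtain ⟨N, a, b, hF⟩ := h.polygonal
  let seg : Fin N → Set Plane := fun i => segment ℝ (a i) (b i)
  have hclosed : ∀ i, IsClosed (seg i) := fun i => by
    have : IsCompact (seg i) := by
      change IsCompact (segment ℝ (a i) (b i))
      rw [segment_eq_image']
      exact isCompact_Icc.image (by fun_prop)
    exact this.isClosed
  refine ⟨(Set.range a ∪ Set.range b) ∪
    ⋃ p : {p : Fin N × Fin N // (seg p.1 ∩ seg p.2).Subsingleton}, seg p.1.1 ∩ seg p.1.2, ?_, ?_⟩
  · exact ((Set.finite_range a).union (Set.finite_range b)).union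
      (Set.finite_iUnion fun p => p.2.finite)
  intro x hx hS
  simp only [Set.mem_union, Set.mem_iUnion, not_or, not_exists] at hS
  obtain ⟨⟨ha, hb⟩, hcross⟩ := hS
  obtain ⟨i, hi⟩ : ∃ i, x ∈ seg i := by rw [hF] at hx; exact Set.mem_iUnion.1 hx
  have hxa : x ≠ a i := fun e => ha ⟨i, e.symm⟩
  have hxb : x ≠ b i := fun e => hb ⟨i, e.symm⟩
  set v := b i - a i with hv
  have hv0 : v ≠ 0 := by
    intro h0
    have : b i = a i := sub_eq_zero.1 h0
    have hi' : x ∈ segment ℝ (a i) (b i) := hi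
    rw [this, segment_same] at hi'
    exact hxa hi'
  have hvn : 0 < ‖v‖ := norm_pos_iff.2 hv0
  have hai : inner ℝ (rot v) (b i - a i) = 0 := inner_rot_self v
  have hcol : ∀ j, x ∈ seg j → ∀ z ∈ seg j, inner ℝ (rot v) (z - x) = 0 := by
    intro j hj z hz
    have hns : ¬ (seg i ∩ seg j).Subsingleton := fun hs => hcross ⟨(i, j), hs⟩ ⟨hi, hj⟩
    rw [Set.not_subsingleton_iff] at hns
    obtain ⟨y, ⟨hyi, hyj⟩, hyx⟩ := hns.exists_ne x
    refine inner_rot_sub_eq_zero_of_mem_segment hj hyj hz hyx ?_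
    have hi' : x ∈ segment ℝ (a i) (b i) := hi
    have hyi' : y ∈ segment ℝ (a i) (b i) := hyi
    rw [segment_eq_image'] at hi' hyi'
    obtain ⟨t, -, rfl⟩ := hi'
    obtain ⟨s, -, rfl⟩ := hyi'
    simp only []
    rw [show a i + s • (b i - a i) - (a i + t • (b i - a i)) = (s - t) • (b i - a i) by module,
      inner_smul_right, hai, mul_zero]
  -- The segments that do not contain `x` stay away from it.
  have hfar : IsClosed (⋃ j : {j : Fin N // x ∉ seg j}, seg j) :=
    isClosed_iUnion_of_finite fun j => hclosed j
  have hxfar : x ∈ (⋃ j : {j : Fin N // x ∉ seg j}, seg j)ᶜ := by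
    simp only [Set.mem_compl_iff, Set.mem_iUnion, not_exists]
    exact fun j => j.2
  obtain ⟨r, hr, hball⟩ := Metric.isOpen_iff.1 hfar.isOpen_compl x hxfar
  obtain ⟨δ, hδ, hseg⟩ := exists_pos_forall_add_smul_mem_segment hi hxa hxb
  have hinner : ∀ w : Plane, inner ℝ (‖v‖⁻¹ • rot v) w = 0 ↔ inner ℝ (rot v) w = 0 := by
    intro w
    rw [real_inner_smul_left, mul_eq_zero, or_iff_right (inv_ne_zero hvn.ne')]
  refine exists_isOuterUnitNormal_of_frontier_eq_line h.isOpen h.interior_closure hx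
    (n := ‖v‖⁻¹ • rot v) (r := min r (δ * ‖v‖)) ?_ (by positivity) ?_
  · rw [norm_smul, norm_rot, norm_inv, norm_norm, inv_mul_cancel₀ hvn.ne']
  · intro y hy
    rw [hinner, hF]
    constructor
    · intro hyF
      obtain ⟨j, hj⟩ := Set.mem_iUnion.1 hyF
      by_cases hxj : x ∈ seg j
      · exact hcol j hxj y hj
      · exact absurd (Set.mem_iUnion.2 ⟨⟨j, hxj⟩, hj⟩)
          (hball (Metric.ball_subset_ball (min_le_left _ _) hy))
    · intro h0
      obtain ⟨s, hs⟩ := exists_smul_eq_of_inner_rot_eq_zero hv0 h0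
      have hy' : y = x + s • (b i - a i) := by rw [← hv, ← hs]; abel
      have hlt : |s| < δ := by
        have h1 := Metric.ball_subset_ball (min_le_right _ _) hy
        rw [Metric.mem_ball, dist_eq_norm, hs, norm_smul, Real.norm_eq_abs] at h1
        exact lt_of_mul_lt_mul_right h1 hvn.le
      exact Set.mem_iUnion.2 ⟨i, hy' ▸ hseg s hlt⟩

/-! ### Functionals on spaces of continuous functions -/

/-- If `f` has the partial derivative `f'` in the real variable, and both are jointly continuous,
then `f`, as a curve in `C(X, ℝ)`, has derivative `f'`. -/
theorem hasDerivAt_curry {X : Type*} [TopologicalSpace X] [CompactSpace X] (f f' : C(ℝ × X, ℝ))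
    (h : ∀ t x, HasDerivAt (fun s => f (s, x)) (f' (t, x)) t) (t : ℝ) :
    HasDerivAt (fun s => f.curry s) (f'.curry t) t := by
  have hc : Continuous fun s => f'.curry s := f'.curry.continuous
  have key : (fun s => f.curry s) = fun u => f.curry 0 + ∫ s in (0 : ℝ)..u, f'.curry s := by
    funext u
    ext x
    have e := (ContinuousMap.evalCLM ℝ x : C(X, ℝ) →L[ℝ] ℝ).intervalIntegral_comp_comm
      (hc.intervalIntegrable (μ := volume) 0 u)
    simp only [ContinuousMap.evalCLM_apply, ContinuousMap.curry_apply] at e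
    have e2 := intervalIntegral.integral_eq_sub_of_hasDerivAt (a := (0 : ℝ)) (b := u)
      (f := fun s => f (s, x)) (f' := fun s => f' (s, x)) (fun s _ => h s x)
      (Continuous.intervalIntegrable (by fun_prop) _ _)
    rw [ContinuousMap.add_apply, ← e, e2]
    simp
  rw [key]
  exact (intervalIntegral.integral_hasDerivAt_right (hc.intervalIntegrable _ _)
    (hc.stronglyMeasurableAtFilter _ _) hc.continuousAt).const_add _

section Dilate

variable {K : Set ℝ}

/-- The function `s ↦ g (a s + c)` on `K`. -/
def dilate (K : Set ℝ) (g : ℝ → ℝ) (hg : Continuous g) (a c : ℝ) : C(K, ℝ) :=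
  ⟨fun s => g (a * s + c), by fun_prop⟩

/-- The function `s ↦ s ^ k` on `K`. -/
def powMap (K : Set ℝ) (k : ℕ) : C(K, ℝ) := ⟨fun s => (s : ℝ) ^ k, by fun_prop⟩

theorem continuous_dilate_left {g : ℝ → ℝ} (hg : Continuous g) (c : ℝ) :
    Continuous fun a => dilate K g hg a c :=
  (ContinuousMap.curry (⟨fun p : ℝ × K => g (p.1 * p.2 + c), by fun_prop⟩ : C(ℝ × K, ℝ))).continuous

theorem continuous_dilate_right {g : ℝ → ℝ} (hg : Continuous g) (a : ℝ) :
    Continuous fun c => dilate K g hg a c :=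
  (ContinuousMap.curry (⟨fun p : ℝ × K => g (a * p.2 + p.1), by fun_prop⟩ : C(ℝ × K, ℝ))).continuous

/-- A functional that vanishes on the proper dilates of `g` also vanishes on the constants `g c`,
which are limits of such dilates. -/
theorem map_dilate_eq_zero {g : ℝ → ℝ} (hg : Continuous g) (l : C(K, ℝ) →L[ℝ] ℝ)
    (hl : ∀ a c : ℝ, a ≠ 0 → l (dilate K g hg a c) = 0) (a c : ℝ) : l (dilate K g hg a c) = 0 := by
  have h1 : Continuous fun a => l (dilate K g hg a c) :=
    l.continuous.comp (continuous_dilate_left hg c)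
  have h2 : Set.EqOn (fun a => l (dilate K g hg a c)) (fun _ => 0) ({0}ᶜ : Set ℝ) :=
    fun a ha => hl a c ha
  exact congrFun (h1.ext_on (dense_compl_singleton 0) continuous_const h2) a

variable [CompactSpace K]

/-- A functional that vanishes on the translates of `g` vanishes on their superpositions. -/
theorem map_dilate_convolution_eq_zero {g η : ℝ → ℝ} (hg : Continuous g) (hη : Continuous η)
    (hηc : HasCompactSupport η) (l : C(K, ℝ) →L[ℝ] ℝ)
    (hl : ∀ a c : ℝ, l (dilate K g hg a c) = 0)
    (hT : Continuous (η ⋆[ContinuousLinearMap.lsmul ℝ ℝ, volume] g)) (a c : ℝ) :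
    l (dilate K (η ⋆[ContinuousLinearMap.lsmul ℝ ℝ, volume] g) hT a c) = 0 := by
  have hF : Continuous fun t => η t • dilate K g hg a (c - t) :=
    hη.smul ((continuous_dilate_right hg a).comp (by fun_prop : Continuous fun t : ℝ => c - t))
  have hFi : Integrable (fun t => η t • dilate K g hg a (c - t)) :=
    hF.integrable_of_hasCompactSupport hηc.smul_right
  have e : dilate K (η ⋆[ContinuousLinearMap.lsmul ℝ ℝ, volume] g) hT a c
      = ∫ t, η t • dilate K g hg a (c - t) := by
    ext x
    have e := (ContinuousMap.evalCLM ℝ x : C(K, ℝ) →L[ℝ] ℝ).integral_comp_comm hFi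
    simp only [ContinuousMap.evalCLM_apply] at e
    rw [← e]
    simp [dilate, convolution_def, add_sub_assoc]
  rw [e, ← l.integral_comp_comm hFi]
  simp [hl]

/-- If a functional vanishes on all dilates of a smooth function `T`, then differentiating `k` times
in the dilation parameter at `0` gives that it vanishes on `T⁽ᵏ⁾(c) sᵏ`. -/
theorem map_powMap_mul_iteratedDeriv_eq_zero {T : ℝ → ℝ} (hT : ContDiff ℝ ∞ T)
    (l : C(K, ℝ) →L[ℝ] ℝ) (hl : ∀ a c : ℝ, l (dilate K T hT.continuous a c) = 0) (k : ℕ) (c : ℝ) :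
    iteratedDeriv k T c * l (powMap K k) = 0 := by
  have hcont : ∀ k, Continuous (iteratedDeriv k T) := fun k =>
    hT.continuous_iteratedDeriv k (by exact_mod_cast le_top)
  let F : ℕ → C(ℝ × K, ℝ) := fun k =>
    ⟨fun p => (p.2 : ℝ) ^ k * iteratedDeriv k T (p.1 * p.2 + c), by
      have := hcont k
      fun_prop⟩
  have hF : ∀ k a, l ((F k).curry a) = 0 := by
    intro k
    induction k with
    | zero =>
      intro a
      convert hl a c using 2
      ext x
      simp [F, dilate]
    | succ k ih =>
      intro a
      have hd : HasDerivAt (fun s => (F k).curry s) ((F (k + 1)).curry a) a := by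
        refine hasDerivAt_curry _ _ (fun t x => ?_) a
        have h1 : HasDerivAt (iteratedDeriv k T) (iteratedDeriv (k + 1) T (t * x + c))
            (t * x + c) := by
          rw [iteratedDeriv_succ]
          exact ((hT.differentiable_iteratedDeriv k
            (by exact_mod_cast ENat.natCast_lt_top k)) _).hasDerivAt
        have h2 : HasDerivAt (fun s : ℝ => s * (x : ℝ) + c) (x : ℝ) t := by
          simpa using ((hasDerivAt_id t).mul_const (x : ℝ)).add_const c
        have h3 : HasDerivAt (fun s => (x : ℝ) ^ k * iteratedDeriv k T (s * x + c))
            ((x : ℝ) ^ k * (iteratedDeriv (k + 1) T (t * x + c) * x)) t :=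
          (h1.comp t h2).const_mul ((x : ℝ) ^ k)
        have e : F (k + 1) (t, x) = (x : ℝ) ^ k * (iteratedDeriv (k + 1) T (t * x + c) * x) := by
          change (x : ℝ) ^ (k + 1) * iteratedDeriv (k + 1) T (t * x + c) = _
          ring
        rw [e]
        exact h3
      have h1 := l.hasFDerivAt.comp_hasDerivAt a hd
      have h2 : (l ∘ fun s => (F k).curry s) = fun _ => 0 := funext ih
      rw [h2] at h1
      exact h1.unique (hasDerivAt_const a 0)
  have h0 := hF k 0
  rw [show (F k).curry 0 = iteratedDeriv k T c • powMap K k by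
    ext x; simp [F, powMap, mul_comm]] at h0
  simpa using h0

/-- By the Weierstrass theorem, a functional that vanishes on the monomials is zero. -/
theorem eq_zero_of_map_powMap_eq_zero (l : C(K, ℝ) →L[ℝ] ℝ) (hl : ∀ k, l (powMap K k) = 0) :
    l = 0 := by
  have hp : ∀ p : Polynomial ℝ, l (p.toContinuousMapOn K) = 0 := by
    intro p
    induction p using Polynomial.induction_on' with
    | add p q hp hq =>
      have : (p + q).toContinuousMapOn K = p.toContinuousMapOn K + q.toContinuousMapOn K := by
        ext x; simp
      rw [this, map_add, hp, hq, add_zero]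
    | monomial n a =>
      have : (Polynomial.monomial n a).toContinuousMapOn K = a • powMap K n := by
        ext x; simp [powMap]
      rw [this, map_smul, hl, smul_zero]
  have hd : Dense ((polynomialFunctions K : Subalgebra ℝ C(K, ℝ)) : Set C(K, ℝ)) := by
    rw [dense_iff_closure_eq, ← Subalgebra.topologicalClosure_coe,
      polynomialFunctions.topologicalClosure]
    rfl
  have : (l : C(K, ℝ) → ℝ) = fun _ => 0 := by
    refine l.continuous.ext_on hd continuous_const ?_
    intro f hf
    rw [polynomialFunctions_coe] at hf
    obtain ⟨p, rfl⟩ := hf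
    exact hp p
  ext f
  exact congrFun this f

end Dilate

/-! ### Bounded functions are not polynomials -/

theorem exists_derivative_eq (p : Polynomial ℝ) : ∃ q : Polynomial ℝ, q.derivative = p := by
  induction p using Polynomial.induction_on' with
  | add p q hp hq =>
    obtain ⟨p', rfl⟩ := hp
    obtain ⟨q', rfl⟩ := hq
    exact ⟨p' + q', by simp⟩
  | monomial n a =>
    refine ⟨Polynomial.monomial (n + 1) (a / (n + 1)), ?_⟩
    rw [Polynomial.derivative_monomial]
    have : (n : ℝ) + 1 ≠ 0 := by positivity
    simp [this]

theorem exists_polynomial_of_iteratedDeriv_eq_zero (k : ℕ) :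
    ∀ f : ℝ → ℝ, ContDiff ℝ ∞ f → (∀ x, iteratedDeriv k f x = 0) →
      ∃ p : Polynomial ℝ, ∀ x, f x = p.eval x := by
  induction k with
  | zero => exact fun f _ h => ⟨0, fun x => by simpa using h x⟩
  | succ k ih =>
    intro f hf h
    obtain ⟨p, hp⟩ := ih (deriv f) (contDiff_infty_iff_deriv.1 hf).2
      (fun x => by rw [← iteratedDeriv_succ']; exact h x)
    obtain ⟨q, rfl⟩ := exists_derivative_eq p
    have hd : ∀ x, HasDerivAt (fun x => f x - q.eval x) 0 x := by
      intro x
      have h1 := ((contDiff_infty_iff_deriv.1 hf).1 x).hasDerivAt.sub (q.hasDerivAt x)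
      rw [hp x, sub_self] at h1
      exact h1
    refine ⟨q + Polynomial.C (f 0 - q.eval 0), fun x => ?_⟩
    have := is_const_of_deriv_eq_zero (fun x => (hd x).differentiableAt) (fun x => (hd x).deriv) x 0
    simp only [Polynomial.eval_add, Polynomial.eval_C]
    linarith

theorem eq_of_bounded_of_iteratedDeriv_eq_zero {f : ℝ → ℝ} (hf : ContDiff ℝ ∞ f) {M : ℝ}
    (hM : ∀ x, |f x| ≤ M) {k : ℕ} (hk : ∀ x, iteratedDeriv k f x = 0) (x y : ℝ) : f x = f y := by
  obtain ⟨p, hp⟩ := exists_polynomial_of_iteratedDeriv_eq_zero k f hf hk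
  have hdeg : p.degree ≤ 0 := by
    by_contra! h
    have h1 := p.abs_tendsto_atTop h
    obtain ⟨z, hz⟩ := (h1.eventually_gt_atTop M).exists
    rw [← hp] at hz
    exact absurd (hM z) (not_le.2 hz)
  rw [hp, hp, Polynomial.eq_C_of_degree_le_zero hdeg]
  simp

/-! ### Mollified activation functions -/

/-- Integration by parts moves a derivative from one factor of a convolution to the other. -/
theorem convolution_deriv_right_eq {η f : ℝ → ℝ} (hη : ContDiff ℝ 1 η) (hηc : HasCompactSupport η)
    (hf : ContDiff ℝ 1 f) :
    (η ⋆[ContinuousLinearMap.lsmul ℝ ℝ, volume] deriv f)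
      = deriv η ⋆[ContinuousLinearMap.lsmul ℝ ℝ, volume] f := by
  funext x
  have hd : ∀ t, HasDerivAt (fun t => f (x - t)) (-deriv f (x - t)) t := by
    intro t
    have h1 := ((hf.differentiable one_ne_zero) (x - t)).hasDerivAt
    have h2 : HasDerivAt (fun t : ℝ => x - t) (-1) t := by
      simpa using (hasDerivAt_id t).const_sub x
    have h3 : HasDerivAt (fun t => f (x - t)) (deriv f (x - t) * -1) t := h1.comp t h2
    rwa [mul_neg_one] at h3
  have c1 := hη.continuous
  have c2 := hη.continuous_deriv_one
  have c3 := hf.continuous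
  have c4 := hf.continuous_deriv_one
  have e := integral_mul_deriv_eq_deriv_mul_of_integrable (u := η) (v := fun t => f (x - t))
    (u' := deriv η) (v' := fun t => -deriv f (x - t))
    (fun t _ => ((hη.differentiable one_ne_zero) t).hasDerivAt) (fun t _ => hd t)
    (Continuous.integrable_of_hasCompactSupport (by fun_prop) hηc.mul_right)
    (Continuous.integrable_of_hasCompactSupport (by fun_prop) hηc.deriv.mul_right)
    (Continuous.integrable_of_hasCompactSupport (by fun_prop) hηc.mul_right)
  simp only [convolution_def, ContinuousLinearMap.lsmul_apply, smul_eq_mul]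
  simp only [mul_neg, integral_neg, neg_inj] at e
  exact e

theorem contDiff_one_deriv {f : ℝ → ℝ} (hf : ContDiff ℝ 2 f) : ContDiff ℝ 1 (deriv f) := by
  have : ContDiff ℝ (1 + 1) f := hf
  exact (contDiff_succ_iff_deriv.1 this).2.2

/-- Some mollification of a bounded, continuous, non-constant function has no identically vanishing
derivative: otherwise all mollifications would be bounded polynomials, that is, constants. -/
theorem exists_mollifier {φ : ℝ → ℝ} (hφ : Continuous φ) {M : ℝ} (hM : ∀ s, |φ s| ≤ M)
    (hne : ¬ ∃ c : ℝ, ∀ s, φ s = c) :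
    ∃ η : ℝ → ℝ, ContDiff ℝ ∞ η ∧ HasCompactSupport η ∧
      ∀ k, ∃ c, iteratedDeriv k (η ⋆[ContinuousLinearMap.lsmul ℝ ℝ, volume] φ) c ≠ 0 := by
  by_contra! hcon
  apply hne
  let b : ℕ → ContDiffBump (0 : ℝ) := fun n =>
    { rIn := 1 / (n + 1 : ℝ) / 2, rOut := 1 / (n + 1 : ℝ), rIn_pos := by positivity,
      rIn_lt_rOut := half_lt_self (by positivity) }
  have hb : Tendsto (fun n => (b n).rOut) atTop (𝓝 0) := tendsto_one_div_add_atTop_nhds_zero_nat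
  have hconst : ∀ n x y,
      ((b n).normed volume ⋆[ContinuousLinearMap.lsmul ℝ ℝ, volume] φ) x
        = ((b n).normed volume ⋆[ContinuousLinearMap.lsmul ℝ ℝ, volume] φ) y := by
    intro n x y
    have hs : ContDiff ℝ ∞ ((b n).normed volume) := (b n).contDiff_normed
    have hc : HasCompactSupport ((b n).normed volume) := (b n).hasCompactSupport_normed
    obtain ⟨k, hk⟩ := hcon _ hs hc
    refine eq_of_bounded_of_iteratedDeriv_eq_zero (M := ∫ t, |(b n).normed volume t| * M)
      (hc.contDiff_convolution_left _ hs hφ.locallyIntegrable) (fun z => ?_) hk x y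
    rw [convolution_def, ← Real.norm_eq_abs]
    refine norm_integral_le_of_norm_le
      ((((hs.continuous.integrable_of_hasCompactSupport hc)).abs).mul_const M) ?_
    refine Eventually.of_forall fun t => ?_
    simp only [ContinuousLinearMap.lsmul_apply, smul_eq_mul, Real.norm_eq_abs, abs_mul]
    exact mul_le_mul_of_nonneg_left (hM _) (abs_nonneg _)
  have hlim := fun x => ContDiffBump.convolution_tendsto_right_of_continuous (μ := volume) hb hφ x
  refine ⟨φ 0, fun s => tendsto_nhds_unique (hlim s) ?_⟩
  simp only [hconst _ s 0]
  exact hlim 0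

/-- No nonzero functional on `C(K)` annihilates all dilates of the second derivative of an
activation function. -/
theorem IsActivation.functional_eq_zero {φ : ℝ → ℝ} (hφ : IsActivation φ) {K : Set ℝ}
    [CompactSpace K] (hg : Continuous (deriv (deriv φ))) (l : C(K, ℝ) →L[ℝ] ℝ)
    (hl : ∀ a c : ℝ, a ≠ 0 → l (dilate K _ hg a c) = 0) : l = 0 := by
  obtain ⟨M, hM⟩ := hφ.bounded
  obtain ⟨η, hη, hηc, hk⟩ := exists_mollifier hφ.contDiff.continuous hM hφ.nonconstant
  have hφ1 : ContDiff ℝ 1 (deriv φ) := contDiff_one_deriv hφ.contDiff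
  have hη1 : ContDiff ℝ ∞ (deriv η) := (contDiff_infty_iff_deriv.1 hη).2
  have hli : LocallyIntegrable φ := hφ.contDiff.continuous.locallyIntegrable
  have hT : ContDiff ℝ ∞ (η ⋆[ContinuousLinearMap.lsmul ℝ ℝ, volume] deriv (deriv φ)) :=
    hηc.contDiff_convolution_left _ hη hg.locallyIntegrable
  have hder : ∀ θ : ℝ → ℝ, ContDiff ℝ ∞ θ → HasCompactSupport θ →
      deriv (θ ⋆[ContinuousLinearMap.lsmul ℝ ℝ, volume] φ)
        = deriv θ ⋆[ContinuousLinearMap.lsmul ℝ ℝ, volume] φ := by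
    intro θ hθ hθc
    funext x
    exact (hθc.hasDerivAt_convolution_left _ (hθ.of_le (by exact_mod_cast le_top)) hli x).deriv
  have e : (η ⋆[ContinuousLinearMap.lsmul ℝ ℝ, volume] deriv (deriv φ))
      = deriv (deriv (η ⋆[ContinuousLinearMap.lsmul ℝ ℝ, volume] φ)) := by
    rw [convolution_deriv_right_eq (hη.of_le (by exact_mod_cast le_top)) hηc hφ1,
      convolution_deriv_right_eq (hη1.of_le (by exact_mod_cast le_top)) hηc.deriv
        (hφ.contDiff.of_le one_le_two), hder η hη hηc, hder _ hη1 hηc.deriv]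
  have hl' := map_dilate_eq_zero hg l hl
  have hl'' := map_dilate_convolution_eq_zero hg hη.continuous hηc l hl' hT.continuous
  refine eq_zero_of_map_powMap_eq_zero l fun k => ?_
  obtain ⟨c, hc⟩ := hk (k + 2)
  have := map_powMap_mul_iteratedDeriv_eq_zero hT l hl'' k c
  rw [e, ← iteratedDeriv_succ', ← iteratedDeriv_succ'] at this
  exact (mul_eq_zero.1 this).resolve_left hc

/-- By the Hahn-Banach theorem, the proper dilates of `φ''` span a dense subspace of `C(K)`. -/
theorem IsActivation.dense_span_dilate {φ : ℝ → ℝ} (hφ : IsActivation φ) {K : Set ℝ}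
    [CompactSpace K] (hg : Continuous (deriv (deriv φ))) :
    (Submodule.span ℝ {f : C(K, ℝ) | ∃ a c : ℝ, a ≠ 0 ∧ f = dilate K _ hg a c}).topologicalClosure
      = ⊤ := by
  rw [Submodule.eq_top_iff']
  intro f
  set V := (Submodule.span ℝ
    {f : C(K, ℝ) | ∃ a c : ℝ, a ≠ 0 ∧ f = dilate K _ hg a c}).topologicalClosure with hV
  by_contra hf
  obtain ⟨l, u, h1, h2⟩ := geometric_hahn_banach_closed_point (s := (V : Set C(K, ℝ)))
    V.convex (Submodule.isClosed_topologicalClosure _) hf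
  have hzero : ∀ v ∈ V, l v = 0 := by
    intro v hv
    by_contra hne
    have := h1 ((u / l v) • v) (V.smul_mem _ hv)
    rw [map_smul, smul_eq_mul, div_mul_cancel₀ _ hne] at this
    exact lt_irrefl _ this
  have hl0 : l = 0 := hφ.functional_eq_zero hg l fun a c ha =>
    hzero _ (Submodule.le_topologicalClosure _ (Submodule.subset_span ⟨a, c, ha, rfl⟩))
  have h3 := h1 0 V.zero_mem
  rw [hl0] at h2 h3
  simp only [zero_apply] at h2 h3
  exact absurd h2 (not_lt.2 h3.le)

/-! ### Approximation of the exponential by one-dimensional networks -/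

/-- The span of the functions `s ↦ φ (a s + c)`. -/
def lineNets (φ : ℝ → ℝ) : Submodule ℝ (ℝ → ℝ) :=
  Submodule.span ℝ {f | ∃ a c : ℝ, f = fun s => φ (a * s + c)}

theorem lineNets_contDiff {φ : ℝ → ℝ} (hφ : ContDiff ℝ 2 φ) {f : ℝ → ℝ} (hf : f ∈ lineNets φ) :
    ContDiff ℝ 2 f := by
  induction hf using Submodule.span_induction with
  | mem f hf =>
    obtain ⟨a, c, rfl⟩ := hf
    exact hφ.comp (by fun_prop)
  | zero => exact contDiff_const
  | add f g _ _ hf hg => exact hf.add hg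
  | smul a f _ hf => exact hf.const_smul a

/-- Integrating a bound on the second derivative twice. -/
theorem abs_le_of_abs_deriv_deriv_le {F : ℝ → ℝ} (hF : ContDiff ℝ 2 F) {S η : ℝ} (hS : 0 ≤ S)
    (h0 : F 0 = 0) (h1 : deriv F 0 = 0)
    (h2 : ∀ s ∈ Set.Icc (-S) S, |deriv (deriv F) s| ≤ η) :
    ∀ s ∈ Set.Icc (-S) S, |deriv F s| ≤ η * S ∧ |F s| ≤ η * S * S := by
  have hF1 : ContDiff ℝ 1 (deriv F) := contDiff_one_deriv hF
  have hz : (0 : ℝ) ∈ Set.Icc (-S) S := ⟨by linarith, hS⟩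
  have hη : 0 ≤ η := (abs_nonneg _).trans (h2 0 hz)
  have hb : ∀ s ∈ Set.Icc (-S) S, ‖s - 0‖ ≤ S := fun s hs => by
    rw [sub_zero, Real.norm_eq_abs, abs_le]; exact hs
  have hd : ∀ s ∈ Set.Icc (-S) S, |deriv F s| ≤ η * S := by
    intro s hs
    have := (convex_Icc (-S) S).norm_image_sub_le_of_norm_deriv_le (f := deriv F) (C := η)
      (fun x _ => (hF1.differentiable one_ne_zero) x) (fun x hx => h2 x hx) hz hs
    rw [h1, sub_zero] at this
    exact this.trans (mul_le_mul_of_nonneg_left (hb s hs) hη)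
  intro s hs
  refine ⟨hd s hs, ?_⟩
  have := (convex_Icc (-S) S).norm_image_sub_le_of_norm_deriv_le (f := F) (C := η * S)
    (fun x _ => (hF.differentiable two_ne_zero) x) (fun x hx => hd x hx) hz hs
  rw [h0, sub_zero] at this
  exact this.trans (mul_le_mul_of_nonneg_left (hb s hs) (by positivity))

theorem deriv_comp_affine {f : ℝ → ℝ} (hf : Differentiable ℝ f) (a c : ℝ) :
    deriv (fun s => f (a * s + c)) = fun s => a * deriv f (a * s + c) := by
  funext s
  have h2 : HasDerivAt (fun s : ℝ => a * s + c) a s := by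
    simpa using ((hasDerivAt_id s).const_mul a).add_const c
  have h3 : HasDerivAt (fun s => f (a * s + c)) (deriv f (a * s + c) * a) s :=
    (hf (a * s + c)).hasDerivAt.comp s h2
  rw [h3.deriv, mul_comm]

/-- Constants are networks, and linear functions are limits of networks: the difference quotients
`(φ (a s + c) - φ c) / (a φ' c)` have value `0` and slope `1` at `0`, and a small second
derivative. -/
theorem IsActivation.exists_lineNets_affine {φ : ℝ → ℝ} (hφ : IsActivation φ) (A B S : ℝ) {η : ℝ}
    (hη : 0 < η) :
    ∃ H ∈ lineNets φ, H 0 = B ∧ deriv H 0 = A ∧ ∀ s ∈ Set.Icc (-S) S, |deriv (deriv H) s| ≤ η := by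
  have hdiff : Differentiable ℝ φ := hφ.contDiff.differentiable two_ne_zero
  have hdiff1 : Differentiable ℝ (deriv φ) := (contDiff_one_deriv hφ.contDiff).differentiable one_ne_zero
  have hc2 : Continuous (deriv (deriv φ)) := (contDiff_one_deriv hφ.contDiff).continuous_deriv_one
  obtain ⟨c₀, hc₀⟩ : ∃ c, φ c ≠ 0 := by
    by_contra! h
    exact hφ.nonconstant ⟨0, h⟩
  obtain ⟨c, hc⟩ : ∃ c, deriv φ c ≠ 0 := by
    by_contra! h
    exact hφ.nonconstant ⟨φ 0, fun s => is_const_of_deriv_eq_zero hdiff h s 0⟩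
  have hcont : Continuous fun p : ℝ × ℝ => A * (p.1 * deriv (deriv φ) (p.1 * p.2 + c)) / deriv φ c :=
    by fun_prop
  -- For small `a` the second derivative is small, uniformly on the compact interval.
  have hsmall : ∀ᶠ a in 𝓝 (0 : ℝ), ∀ s ∈ Set.Icc (-S) S,
      |A * (a * deriv (deriv φ) (a * s + c)) / deriv φ c| < η := by
    refine isCompact_Icc.eventually_forall_of_forall_eventually fun s _ => ?_
    refine (hcont.abs.tendsto (0, s)).eventually (gt_mem_nhds ?_)
    simpa using hη
  obtain ⟨a, ha, ha0⟩ : ∃ a : ℝ, (∀ s ∈ Set.Icc (-S) S,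
      |A * (a * deriv (deriv φ) (a * s + c)) / deriv φ c| < η) ∧ a ≠ 0 := by
    have h1 : ∀ᶠ a in 𝓝[≠] (0 : ℝ), ∀ s ∈ Set.Icc (-S) S,
      |A * (a * deriv (deriv φ) (a * s + c)) / deriv φ c| < η := hsmall.filter_mono nhdsWithin_le_nhds
    exact (h1.and self_mem_nhdsWithin).exists
  have hmem : ∀ a c : ℝ, (fun s => φ (a * s + c)) ∈ lineNets φ := fun a c =>
    Submodule.subset_span ⟨a, c, rfl⟩
  set κ := A / (a * deriv φ c) with hκ
  have hfun : (κ • (fun s => φ (a * s + c)) - κ • (fun s => φ (0 * s + c))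
      + (B / φ c₀) • fun s => φ (0 * s + c₀)) =
      fun s => κ * φ (a * s + c) + (B - κ * φ c) := by
    funext s
    simp
    field_simp
    ring
  refine ⟨fun s => κ * φ (a * s + c) + (B - κ * φ c), ?_, ?_, ?_, ?_⟩
  · rw [← hfun]
    exact Submodule.add_mem _ (Submodule.sub_mem _ (Submodule.smul_mem _ _ (hmem _ _))
      (Submodule.smul_mem _ _ (hmem _ _))) (Submodule.smul_mem _ _ (hmem _ _))
  · simp
  all_goals
    have hd : deriv (fun s => κ * φ (a * s + c) + (B - κ * φ c))
        = fun s => κ * (a * deriv φ (a * s + c)) := by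
      funext s
      have hdc : DifferentiableAt ℝ (fun s => φ (a * s + c)) s := by fun_prop
      rw [deriv_add_const, deriv_const_mul _ hdc, deriv_comp_affine hdiff]
  · rw [hd]
    simp [hκ]
    field_simp
  · intro s hs
    have hdc : DifferentiableAt ℝ (fun s => deriv φ (a * s + c)) s := by fun_prop
    have e : deriv (deriv (fun s => κ * φ (a * s + c) + (B - κ * φ c))) s
        = A * (a * deriv (deriv φ) (a * s + c)) / deriv φ c := by
      rw [hd, deriv_const_mul _ (hdc.const_mul a), deriv_const_mul _ hdc,
        deriv_comp_affine hdiff1, hκ]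
      field_simp
    rw [e]
    exact (ha s hs).le

/-- Networks with second derivative close to `h` on an interval: the density of the dilates of `φ''`,
integrated twice. Dilation factors `a ≠ 0` matter here, since `φ'' (a s + c)` is the second
derivative of `a⁻² φ (a s + c)`. -/
theorem IsActivation.exists_lineNets_deriv_deriv {φ : ℝ → ℝ} (hφ : IsActivation φ) {h : ℝ → ℝ}
    (hh : Continuous h) (S : ℝ) {η : ℝ} (hη : 0 < η) :
    ∃ H ∈ lineNets φ, ∀ s ∈ Set.Icc (-S) S, |h s - deriv (deriv H) s| ≤ η := by
  have hdiff : Differentiable ℝ φ := hφ.contDiff.differentiable two_ne_zero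
  have hdiff1 : Differentiable ℝ (deriv φ) := (contDiff_one_deriv hφ.contDiff).differentiable one_ne_zero
  have hg : Continuous (deriv (deriv φ)) := (contDiff_one_deriv hφ.contDiff).continuous_deriv_one
  have hspan : ∀ f ∈ Submodule.span ℝ
      {f : C(Set.Icc (-S) S, ℝ) | ∃ a c : ℝ, a ≠ 0 ∧ f = dilate _ _ hg a c},
      ∃ H ∈ lineNets φ, ∀ s, f s = deriv (deriv H) s := by
    intro f hf
    induction hf using Submodule.span_induction with
    | mem f hf =>
      obtain ⟨a, c, ha, rfl⟩ := hf
      refine ⟨(a ^ 2)⁻¹ • fun s => φ (a * s + c),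
        Submodule.smul_mem _ _ (Submodule.subset_span ⟨a, c, rfl⟩), fun s => ?_⟩
      have e1 : deriv ((a ^ 2)⁻¹ • fun s => φ (a * s + c))
          = fun s => (a ^ 2)⁻¹ * (a * deriv φ (a * s + c)) := by
        funext s
        have hdc : DifferentiableAt ℝ (fun s => φ (a * s + c)) s := by fun_prop
        rw [show ((a ^ 2)⁻¹ • fun s => φ (a * s + c)) = fun s => (a ^ 2)⁻¹ * φ (a * s + c) from rfl,
          deriv_const_mul _ hdc, deriv_comp_affine hdiff]
      have hdc : DifferentiableAt ℝ (fun s => deriv φ (a * s + c)) (s : ℝ) := by fun_prop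
      rw [e1, deriv_const_mul _ (hdc.const_mul a), deriv_const_mul _ hdc, deriv_comp_affine hdiff1]
      simp only [dilate, ContinuousMap.coe_mk]
      field_simp
    | zero => exact ⟨0, Submodule.zero_mem _, fun s => by
        rw [show (0 : ℝ → ℝ) = fun _ => 0 from rfl]; simp⟩
    | add f g _ _ hf hg' =>
      obtain ⟨F, hF, hf⟩ := hf
      obtain ⟨G, hG, hg'⟩ := hg'
      refine ⟨F + G, Submodule.add_mem _ hF hG, fun s => ?_⟩
      have cF := lineNets_contDiff hφ.contDiff hF
      have cG := lineNets_contDiff hφ.contDiff hG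
      have e1 : deriv (F + G) = deriv F + deriv G := by
        funext t
        exact deriv_add (cF.differentiable two_ne_zero t) (cG.differentiable two_ne_zero t)
      have dF := (contDiff_one_deriv cF).differentiable one_ne_zero
      have dG := (contDiff_one_deriv cG).differentiable one_ne_zero
      rw [e1, deriv_add (dF _) (dG _), ContinuousMap.add_apply, hf, hg']
    | smul a f _ hf =>
      obtain ⟨F, hF, hf⟩ := hf
      refine ⟨a • F, Submodule.smul_mem _ _ hF, fun s => ?_⟩
      have cF := lineNets_contDiff hφ.contDiff hF
      have dF := (contDiff_one_deriv cF).differentiable one_ne_zero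
      have e1 : deriv (a • F) = a • deriv F := by
        funext t
        exact deriv_const_smul a (cF.differentiable two_ne_zero t)
      rw [e1, deriv_const_smul a (dF _), ContinuousMap.smul_apply, hf]
  have htop := hφ.dense_span_dilate (K := Set.Icc (-S) S) hg
  have hmem : (⟨fun s => h s, by fun_prop⟩ : C(Set.Icc (-S) S, ℝ)) ∈ closure
      ((Submodule.span ℝ {f : C(Set.Icc (-S) S, ℝ) | ∃ a c : ℝ, a ≠ 0 ∧ f = dilate _ _ hg a c} :
        Submodule ℝ C(Set.Icc (-S) S, ℝ)) : Set C(Set.Icc (-S) S, ℝ)) := by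
    rw [← Submodule.topologicalClosure_coe, htop]
    trivial
  obtain ⟨f, hf, hdist⟩ := Metric.mem_closure_iff.1 hmem η hη
  obtain ⟨H, hH, e⟩ := hspan f hf
  refine ⟨H, hH, fun s hs => ?_⟩
  have := (ContinuousMap.dist_apply_le_dist (f := (⟨fun s => h s, by fun_prop⟩ :
    C(Set.Icc (-S) S, ℝ))) (g := f) ⟨s, hs⟩).trans hdist.le
  rw [Real.dist_eq, e] at this
  exact this

theorem IsActivation.exists_lineNets_exp {φ : ℝ → ℝ} (hφ : IsActivation φ) {S : ℝ} (hS : 0 ≤ S)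
    {ε : ℝ} (hε : 0 < ε) :
    ∃ H ∈ lineNets φ, ∀ s ∈ Set.Icc (-S) S, ∀ j ≤ 2,
      |iteratedDeriv j (fun s => Real.exp s - H s) s| ≤ ε := by
  set η := ε / (1 + S + S * S) / 2 with hη
  have hden : 0 < 1 + S + S * S := by positivity
  have hη0 : 0 < η := by positivity
  obtain ⟨H₀, hH₀, h₀⟩ := hφ.exists_lineNets_deriv_deriv Real.continuous_exp S hη0
  obtain ⟨H₁, hH₁, hB, hA, h₁⟩ := hφ.exists_lineNets_affine (1 - deriv H₀ 0) (1 - H₀ 0) S hη0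
  have c₀ := lineNets_contDiff hφ.contDiff hH₀
  have c₁ := lineNets_contDiff hφ.contDiff hH₁
  have dd₀ := (contDiff_one_deriv c₀).differentiable one_ne_zero
  have dd₁ := (contDiff_one_deriv c₁).differentiable one_ne_zero
  set F : ℝ → ℝ := fun s => Real.exp s - (H₀ + H₁) s with hF
  have cF : ContDiff ℝ 2 F := Real.contDiff_exp.sub (c₀.add c₁)
  have e1 : deriv F = fun s => Real.exp s - (deriv H₀ s + deriv H₁ s) := by
    funext s
    have := (Real.hasDerivAt_exp s).sub ((c₀.differentiable two_ne_zero s).hasDerivAt.add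
      (c₁.differentiable two_ne_zero s).hasDerivAt)
    exact this.deriv
  have e2 : ∀ s, deriv (deriv F) s = Real.exp s - (deriv (deriv H₀) s + deriv (deriv H₁) s) := by
    intro s
    rw [e1]
    have := (Real.hasDerivAt_exp s).sub ((dd₀ s).hasDerivAt.add (dd₁ s).hasDerivAt)
    exact this.deriv
  have hF2 : ∀ s ∈ Set.Icc (-S) S, |deriv (deriv F) s| ≤ 2 * η := by
    intro s hs
    rw [e2, ← sub_sub]
    exact (abs_sub _ _).trans (by linarith [h₀ s hs, h₁ s hs])
  have hF01 := abs_le_of_abs_deriv_deriv_le cF hS (by simp [hF, hB]) (by rw [e1]; simp [hA]) hF2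
  have hε' : ε = 2 * η * (1 + S + S * S) := by rw [hη]; field_simp
  refine ⟨H₀ + H₁, Submodule.add_mem _ hH₀ hH₁, fun s hs j hj => ?_⟩
  have hpos1 : 0 ≤ 2 * η * S := by positivity
  have hpos2 : 0 ≤ 2 * η * S * S := by positivity
  have hexp : ε = 2 * η + 2 * η * S + 2 * η * S * S := by rw [hε']; ring
  interval_cases j
  · rw [iteratedDeriv_zero]
    exact (hF01 s hs).2.trans (by linarith)
  · rw [iteratedDeriv_one]
    exact (hF01 s hs).1.trans (by linarith)
  · rw [iteratedDeriv_succ, iteratedDeriv_one]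
    exact (hF2 s hs).trans (by linarith)

/-! ### Convolutions and their derivatives -/

/-- Convolution commutes with linear isomorphisms of the target. -/
theorem convolution_comp_equiv {E F : Type*} [NormedAddCommGroup E] [NormedSpace ℝ E]
    [NormedAddCommGroup F] [NormedSpace ℝ F] (I : E ≃L[ℝ] F) (p : Plane → ℝ) (h : Plane → E) :
    (p ⋆[ContinuousLinearMap.lsmul ℝ ℝ, volume] (I ∘ h))
      = I ∘ (p ⋆[ContinuousLinearMap.lsmul ℝ ℝ, volume] h) := by
  funext x
  simp only [convolution_def, ContinuousLinearMap.lsmul_apply, Function.comp_apply]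
  rw [← I.integral_comp_comm]
  simp

theorem fderiv_convolution {E : Type*} [NormedAddCommGroup E] [NormedSpace ℝ E]
    {p : Plane → ℝ} (hp : LocallyIntegrable p) {h : Plane → E} (hh : ContDiff ℝ 1 h)
    (hhc : HasCompactSupport h) :
    fderiv ℝ (p ⋆[ContinuousLinearMap.lsmul ℝ ℝ, volume] h)
      = p ⋆[ContinuousLinearMap.lsmul ℝ ℝ, volume] fderiv ℝ h := by
  funext x
  rw [(hhc.hasFDerivAt_convolution_right _ hp hh x).fderiv]
  rfl

theorem iteratedFDeriv_convolution {F : Type*} [NormedAddCommGroup F] [NormedSpace ℝ F]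
    {p : Plane → ℝ} (hp : LocallyIntegrable p) {f : Plane → F} {n : ℕ} (hf : ContDiff ℝ n f)
    (hfc : HasCompactSupport f) {j : ℕ} (hj : j ≤ n) :
    iteratedFDeriv ℝ j (p ⋆[ContinuousLinearMap.lsmul ℝ ℝ, volume] f)
      = p ⋆[ContinuousLinearMap.lsmul ℝ ℝ, volume] iteratedFDeriv ℝ j f := by
  induction j with
  | zero =>
    rw [iteratedFDeriv_zero_eq_comp, iteratedFDeriv_zero_eq_comp]
    exact (convolution_comp_equiv
      (continuousMultilinearCurryFin0 ℝ Plane F).symm.toContinuousLinearEquiv p f).symm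
  | succ j ih =>
    have hcd : ContDiff ℝ 1 (iteratedFDeriv ℝ j f) :=
      hf.iteratedFDeriv_right (by rw [add_comm]; exact_mod_cast hj)
    rw [iteratedFDeriv_succ_eq_comp_left, iteratedFDeriv_succ_eq_comp_left, ih (by omega),
      fderiv_convolution hp hcd (hfc.iteratedFDeriv j)]
    exact (convolution_comp_equiv
      (E := Plane →L[ℝ] ContinuousMultilinearMap ℝ (fun _ : Fin j => Plane) F)
      (F := ContinuousMultilinearMap ℝ (fun _ : Fin (j + 1) => Plane) F)
      (continuousMultilinearCurryLeftEquiv ℝ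
      (fun _ : Fin (j + 1) => Plane) F).symm.toContinuousLinearEquiv p _).symm

theorem norm_convolution_le_of_abs_le {F : Type*} [NormedAddCommGroup F] [NormedSpace ℝ F]
    {q : Plane → ℝ} {h : Plane → F} (hh : Continuous h) (hhc : HasCompactSupport h) {R R' δ : ℝ}
    (hsupp : ∀ x, h x ≠ 0 → ‖x‖ ≤ R') (hq : ∀ x, ‖x‖ ≤ R + R' → |q x| ≤ δ) {x : Plane}
    (hx : ‖x‖ ≤ R) :
    ‖(q ⋆[ContinuousLinearMap.lsmul ℝ ℝ, volume] h) x‖ ≤ δ * ∫ t, ‖h t‖ := by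
  rw [convolution_lsmul_swap, ← integral_const_mul]
  refine norm_integral_le_of_norm_le
    ((hh.integrable_of_hasCompactSupport hhc).norm.const_mul δ) (Eventually.of_forall fun t => ?_)
  simp only [norm_smul, Real.norm_eq_abs]
  by_cases ht : h t = 0
  · simp [ht]
  · refine mul_le_mul_of_nonneg_right (hq _ ?_) (norm_nonneg _)
    exact (norm_sub_le _ _).trans (add_le_add hx (hsupp t ht))

/-! ### Sums of exponentials -/

/-- The span of the exponentials `x ↦ exp ⟪a, x⟫`. -/
def expSums : Submodule ℝ (Plane → ℝ) :=
  Submodule.span ℝ {f | ∃ a : Plane, f = fun x => Real.exp (inner ℝ a x)}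

theorem expSums_contDiff {f : Plane → ℝ} (hf : f ∈ expSums) (n : ℕ) : ContDiff ℝ n f := by
  induction hf using Submodule.span_induction with
  | mem f hf =>
    obtain ⟨a, rfl⟩ := hf
    exact Real.contDiff_exp.comp (contDiff_const.inner ℝ contDiff_id)
  | zero => exact contDiff_const
  | add f g _ _ hf hg => exact hf.add hg
  | smul a f _ hf => exact hf.const_smul a

/-- The exponentials as a homomorphism to the functions on `K`; its image is closed under products. -/
def expHom (K : Set Plane) : Multiplicative Plane →* C(K, ℝ) where
  toFun a := ⟨fun x => Real.exp (inner ℝ a.toAdd (x : Plane)), by fun_prop⟩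
  map_one' := by ext x; simp
  map_mul' a b := by ext x; simp [inner_add_left, Real.exp_add]

/-- The Stone-Weierstrass theorem for sums of exponentials. -/
theorem exists_expSums_near {q : Plane → ℝ} (hq : Continuous q) (R : ℝ) {δ : ℝ} (hδ : 0 < δ) :
    ∃ p ∈ expSums, ∀ x, ‖x‖ ≤ R → |q x - p x| ≤ δ := by
  set K : Set Plane := Metric.closedBall 0 R with hK
  have : CompactSpace K := isCompact_iff_compactSpace.1 (isCompact_closedBall 0 R)
  set A : Subalgebra ℝ C(K, ℝ) := Algebra.adjoin ℝ (MonoidHom.mrange (expHom K) : Set C(K, ℝ))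
    with hA
  have hsep : A.SeparatesPoints := by
    intro x y hxy
    refine ⟨_, ⟨_, Algebra.subset_adjoin ⟨Multiplicative.ofAdd ((x : Plane) - y), rfl⟩, rfl⟩, ?_⟩
    intro he
    have he' : inner ℝ ((x : Plane) - y) x = inner ℝ ((x : Plane) - y) (y : Plane) :=
      Real.exp_injective he
    rw [← sub_eq_zero, ← inner_sub_right, inner_self_eq_zero, sub_eq_zero] at he'
    exact hxy (Subtype.ext he')
  have htop := ContinuousMap.subalgebra_topologicalClosure_eq_top_of_separatesPoints A hsep
  have hmem : (⟨fun x => q x, by fun_prop⟩ : C(K, ℝ)) ∈ closure (A : Set C(K, ℝ)) := by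
    rw [← Subalgebra.topologicalClosure_coe, htop]
    trivial
  obtain ⟨f, hf, hdist⟩ := Metric.mem_closure_iff.1 hmem δ hδ
  have hspan : ∀ f ∈ Submodule.span ℝ (MonoidHom.mrange (expHom K) : Set C(K, ℝ)),
      ∃ p ∈ expSums, ∀ x, f x = p x := by
    intro f hf
    induction hf using Submodule.span_induction with
    | mem f hf =>
      obtain ⟨a, rfl⟩ := hf
      exact ⟨_, Submodule.subset_span ⟨a.toAdd, rfl⟩, fun x => rfl⟩
    | zero => exact ⟨0, Submodule.zero_mem _, fun x => rfl⟩
    | add f g _ _ hf hg =>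
      obtain ⟨F, hF, hf⟩ := hf
      obtain ⟨G, hG, hg⟩ := hg
      exact ⟨F + G, Submodule.add_mem _ hF hG, fun x => by simp [hf, hg]⟩
    | smul a f _ hf =>
      obtain ⟨F, hF, hf⟩ := hf
      exact ⟨a • F, Submodule.smul_mem _ _ hF, fun x => by simp [hf]⟩
  have hf' : f ∈ Submodule.span ℝ (MonoidHom.mrange (expHom K) : Set C(K, ℝ)) := by
    have h1 : f ∈ Subalgebra.toSubmodule A := hf
    rwa [hA, Algebra.adjoin_eq_span, Submonoid.closure_eq] at h1
  obtain ⟨p, hp, e⟩ := hspan f hf'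
  refine ⟨p, hp, fun x hx => ?_⟩
  have := (ContinuousMap.dist_apply_le_dist (f := (⟨fun x => q x, by fun_prop⟩ : C(K, ℝ))) (g := f)
    ⟨x, by simpa [hK] using hx⟩).trans hdist.le
  rw [Real.dist_eq, e] at this
  exact this

/-- Exponentials are characters, so the convolution of a sum of exponentials with any compactly
supported function is again a sum of exponentials. -/
theorem expSums_convolution {p f : Plane → ℝ} (hp : p ∈ expSums) (hf : Continuous f)
    (hfc : HasCompactSupport f) :
    (p ⋆[ContinuousLinearMap.lsmul ℝ ℝ, volume] f) ∈ expSums := by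
  induction hp using Submodule.span_induction with
  | mem p hp =>
    obtain ⟨a, rfl⟩ := hp
    have e : ((fun x => Real.exp (inner ℝ a x)) ⋆[ContinuousLinearMap.lsmul ℝ ℝ, volume] f)
        = (∫ t, Real.exp (-inner ℝ a t) * f t) • fun x => Real.exp (inner ℝ a x) := by
      funext x
      rw [convolution_lsmul_swap, Pi.smul_apply, smul_eq_mul, mul_comm, ← integral_const_mul]
      refine integral_congr_ae (Eventually.of_forall fun t => ?_)
      simp only [smul_eq_mul]
      rw [inner_sub_right, sub_eq_add_neg, Real.exp_add, mul_assoc]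
    rw [e]
    exact Submodule.smul_mem _ _ (Submodule.subset_span ⟨a, rfl⟩)
  | zero => rw [zero_convolution]; exact Submodule.zero_mem _
  | add p q hp hq ihp ihq =>
    have hex : ∀ p ∈ expSums, ConvolutionExists p f (ContinuousLinearMap.lsmul ℝ ℝ) volume :=
      fun p hp => hfc.convolutionExists_right _
        ((expSums_contDiff hp 0).continuous.locallyIntegrable) hf
    rw [(hex p hp).add_distrib (hex q hq)]
    exact Submodule.add_mem _ ihp ihq
  | smul a p _ ihp =>
    rw [smul_convolution]
    exact Submodule.smul_mem _ _ ihp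

/-! ### Density in the topology of uniform convergence of derivatives -/

/-- `f` can be approximated by members of `V`, together with its derivatives up to order `n` and
uniformly on bounded sets. -/
def IsApprox (n : ℕ) (V : Set (Plane → ℝ)) (f : Plane → ℝ) : Prop :=
  ContDiff ℝ n f ∧ ∀ R ε : ℝ, 0 < ε → ∃ g ∈ V, ContDiff ℝ n g ∧
    ∀ j ≤ n, ∀ x, ‖x‖ ≤ R → ‖iteratedFDeriv ℝ j (f - g) x‖ ≤ ε

theorem iteratedFDeriv_sub_le {f g h : Plane → ℝ} {n j : ℕ} (hf : ContDiff ℝ n f)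
    (hg : ContDiff ℝ n g) (hh : ContDiff ℝ n h) (hj : j ≤ n) (x : Plane) :
    ‖iteratedFDeriv ℝ j (f - h) x‖
      ≤ ‖iteratedFDeriv ℝ j (f - g) x‖ + ‖iteratedFDeriv ℝ j (g - h) x‖ := by
  have hj' : (j : WithTop ℕ∞) ≤ n := by exact_mod_cast hj
  have e : f - h = (f - g) + (g - h) := by abel
  have c1 : ContDiff ℝ j (f - g) := (hf.sub hg).of_le hj'
  have c2 : ContDiff ℝ j (g - h) := (hg.sub hh).of_le hj'
  rw [e, iteratedFDeriv_add_apply c1.contDiffAt c2.contDiffAt]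
  exact norm_add_le _ _

theorem IsApprox.trans {n : ℕ} {V W : Set (Plane → ℝ)} {f : Plane → ℝ} (hf : IsApprox n V f)
    (hV : ∀ g ∈ V, IsApprox n W g) : IsApprox n W f := by
  refine ⟨hf.1, fun R ε hε => ?_⟩
  obtain ⟨g, hg, cg, h1⟩ := hf.2 R (ε / 2) (half_pos hε)
  obtain ⟨h, hh, ch, h2⟩ := (hV g hg).2 R (ε / 2) (half_pos hε)
  refine ⟨h, hh, ch, fun j hj x hx => ?_⟩
  have := iteratedFDeriv_sub_le hf.1 cg ch hj x
  linarith [h1 j hj x hx, h2 j hj x hx]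

theorem IsApprox.mono {n m : ℕ} (hmn : m ≤ n) {V : Set (Plane → ℝ)} {f : Plane → ℝ}
    (hf : IsApprox n V f) : IsApprox m V f := by
  have h : (m : WithTop ℕ∞) ≤ n := by exact_mod_cast hmn
  refine ⟨hf.1.of_le h, fun R ε hε => ?_⟩
  obtain ⟨g, hg, cg, h1⟩ := hf.2 R ε hε
  exact ⟨g, hg, cg.of_le h, fun j hj => h1 j (hj.trans hmn)⟩

theorem IsApprox.add {n : ℕ} {V : Submodule ℝ (Plane → ℝ)} {f g : Plane → ℝ}
    (hf : IsApprox n V f) (hg : IsApprox n V g) : IsApprox n V (f + g) := by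
  refine ⟨hf.1.add hg.1, fun R ε hε => ?_⟩
  obtain ⟨F, hF, cF, h1⟩ := hf.2 R (ε / 2) (half_pos hε)
  obtain ⟨G, hG, cG, h2⟩ := hg.2 R (ε / 2) (half_pos hε)
  refine ⟨F + G, V.add_mem hF hG, cF.add cG, fun j hj x hx => ?_⟩
  have hj' : (j : WithTop ℕ∞) ≤ n := by exact_mod_cast hj
  have e : f + g - (F + G) = (f - F) + (g - G) := by abel
  have c1 : ContDiff ℝ j (f - F) := (hf.1.sub cF).of_le hj'
  have c2 : ContDiff ℝ j (g - G) := (hg.1.sub cG).of_le hj'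
  rw [e, iteratedFDeriv_add_apply c1.contDiffAt c2.contDiffAt]
  exact (norm_add_le _ _).trans (by linarith [h1 j hj x hx, h2 j hj x hx])

theorem IsApprox.smul {n : ℕ} {V : Submodule ℝ (Plane → ℝ)} {f : Plane → ℝ}
    (hf : IsApprox n V f) (a : ℝ) : IsApprox n V (a • f) := by
  refine ⟨hf.1.const_smul a, fun R ε hε => ?_⟩
  obtain ⟨F, hF, cF, h1⟩ := hf.2 R (ε / (|a| + 1)) (by positivity)
  refine ⟨a • F, V.smul_mem a hF, cF.const_smul a, fun j hj x hx => ?_⟩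
  have hj' : (j : WithTop ℕ∞) ≤ n := by exact_mod_cast hj
  have c1 : ContDiff ℝ j (f - F) := (hf.1.sub cF).of_le hj'
  rw [← smul_sub, iteratedFDeriv_const_smul_apply c1.contDiffAt, norm_smul, Real.norm_eq_abs]
  calc |a| * ‖iteratedFDeriv ℝ j (f - F) x‖ ≤ (|a| + 1) * (ε / (|a| + 1)) :=
        mul_le_mul (by linarith) (h1 j hj x hx) (norm_nonneg _) (by positivity)
    _ = ε := by field_simp

theorem IsApprox.of_mem {n : ℕ} {V : Set (Plane → ℝ)} {f : Plane → ℝ} (hf : f ∈ V)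
    (cf : ContDiff ℝ n f) : IsApprox n V f := by
  refine ⟨cf, fun R ε hε => ⟨f, hf, cf, fun j _ x _ => ?_⟩⟩
  rw [sub_self, show (0 : Plane → ℝ) = fun _ => 0 from rfl, iteratedFDeriv_fun_zero]
  simpa using hε.le

/-- A compactly supported function `f` of class `Cⁿ` is close to its mollification `k ⋆ f`, which is
close to `p ⋆ f` if `p` is a sum of exponentials close to the kernel `k`. Since all derivatives fall
on `f`, it is enough that `p` is uniformly close to `k`, without derivatives. -/
theorem isApprox_expSums_of_hasCompactSupport {f : Plane → ℝ} {n : ℕ} (hf : ContDiff ℝ n f)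
    (hfc : HasCompactSupport f) : IsApprox n expSums f := by
  refine ⟨hf, fun R ε hε => ?_⟩
  have hle : ∀ j, j ≤ n → (j : WithTop ℕ∞) ≤ n := fun j hj => by exact_mod_cast hj
  have hcont : ∀ j, j ≤ n → Continuous (iteratedFDeriv ℝ j f) := fun j hj =>
    hf.continuous_iteratedFDeriv (hle j hj)
  obtain ⟨R', hR'⟩ := hfc.isCompact.isBounded.exists_norm_le
  have hsupp : ∀ j x, iteratedFDeriv ℝ j f x ≠ 0 → ‖x‖ ≤ R' := fun j x hx =>
    hR' x (support_iteratedFDeriv_subset j hx)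
  obtain ⟨r, hr, hr0⟩ : ∃ r : ℝ, (∀ j ∈ Finset.range (n + 1), ∀ x y : Plane, dist x y < r →
      dist (iteratedFDeriv ℝ j f x) (iteratedFDeriv ℝ j f y) ≤ ε / 2) ∧ 0 < r := by
    have h1 : ∀ j ∈ Finset.range (n + 1), ∀ᶠ r in 𝓝[>] (0 : ℝ), ∀ x y : Plane, dist x y < r →
        dist (iteratedFDeriv ℝ j f x) (iteratedFDeriv ℝ j f y) ≤ ε / 2 := by
      intro j hj
      have huc := (hfc.iteratedFDeriv (𝕜 := ℝ) j).uniformContinuous_of_continuous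
        (hcont j (by simpa [Nat.lt_succ_iff] using hj))
      obtain ⟨d, hd, h⟩ := Metric.uniformContinuous_iff.1 huc (ε / 2) (half_pos hε)
      filter_upwards [Ioo_mem_nhdsGT hd] with r hr x y hxy
      exact (h (hxy.trans hr.2)).le
    exact (((Finset.range (n + 1)).eventually_all.2 h1).and self_mem_nhdsWithin).exists
  let b : ContDiffBump (0 : Plane) :=
    { rIn := r / 2, rOut := r, rIn_pos := half_pos hr0, rIn_lt_rOut := half_lt_self hr0 }
  set k : Plane → ℝ := b.normed volume with hk
  have kcont : Continuous k := b.continuous_normed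
  set I : ℝ := ∑ j ∈ Finset.range (n + 1), ∫ t, ‖iteratedFDeriv ℝ j f t‖ with hI
  have hI0 : ∀ j, 0 ≤ ∫ t, ‖iteratedFDeriv ℝ j f t‖ := fun j => by positivity
  have hIj : ∀ j, j ≤ n → ∫ t, ‖iteratedFDeriv ℝ j f t‖ ≤ I := fun j hj =>
    Finset.single_le_sum (f := fun j => ∫ t, ‖iteratedFDeriv ℝ j f t‖) (fun i _ => hI0 i)
      (Finset.mem_range.2 (by omega))
  have hI00 : 0 ≤ I := Finset.sum_nonneg fun j _ => hI0 j
  obtain ⟨p, hp, hpk⟩ := exists_expSums_near kcont (R + R') (δ := ε / 2 / (I + 1)) (by positivity)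
  have pcont : Continuous p := (expSums_contDiff hp 0).continuous
  have hpf := expSums_convolution hp hf.continuous hfc
  have ckf : ContDiff ℝ n (k ⋆[ContinuousLinearMap.lsmul ℝ ℝ, volume] f) :=
    hfc.contDiff_convolution_right (n := (n : ℕ∞)) _ kcont.locallyIntegrable hf
  have cpf := expSums_contDiff hpf n
  refine ⟨_, hpf, cpf, fun j hj x hx => ?_⟩
  refine (iteratedFDeriv_sub_le hf ckf cpf hj x).trans ?_
  have h1 : ‖iteratedFDeriv ℝ j (f - (k ⋆[ContinuousLinearMap.lsmul ℝ ℝ, volume] f)) x‖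
      ≤ ε / 2 := by
    rw [iteratedFDeriv_sub_apply (hf.of_le (hle j hj)).contDiffAt (ckf.of_le (hle j hj)).contDiffAt,
      iteratedFDeriv_convolution kcont.locallyIntegrable hf hfc hj, norm_sub_rev, ← dist_eq_norm]
    refine b.dist_normed_convolution_le (hcont j hj).aestronglyMeasurable fun y hy => ?_
    exact hr j (Finset.mem_range.2 (by omega)) _ _ hy
  have h2 : ‖iteratedFDeriv ℝ j ((k ⋆[ContinuousLinearMap.lsmul ℝ ℝ, volume] f)
      - (p ⋆[ContinuousLinearMap.lsmul ℝ ℝ, volume] f)) x‖ ≤ ε / 2 := by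
    have hex : ∀ q : Plane → ℝ, Continuous q →
        ConvolutionExists q f (ContinuousLinearMap.lsmul ℝ ℝ) volume :=
      fun q hq => hfc.convolutionExists_right _ hq.locallyIntegrable hf.continuous
    have e : (k ⋆[ContinuousLinearMap.lsmul ℝ ℝ, volume] f)
        - (p ⋆[ContinuousLinearMap.lsmul ℝ ℝ, volume] f)
        = (k - p) ⋆[ContinuousLinearMap.lsmul ℝ ℝ, volume] f := by
      rw [sub_eq_iff_eq_add, ← (hex (k - p) (kcont.sub pcont)).add_distrib (hex p pcont),
        sub_add_cancel]
    rw [e, iteratedFDeriv_convolution (kcont.sub pcont).locallyIntegrable hf hfc hj]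
    refine (norm_convolution_le_of_abs_le (hcont j hj) (hfc.iteratedFDeriv j) (hsupp j)
      (q := k - p) hpk hx).trans ?_
    calc ε / 2 / (I + 1) * ∫ t, ‖iteratedFDeriv ℝ j f t‖ ≤ ε / 2 / (I + 1) * (I + 1) :=
          mul_le_mul_of_nonneg_left ((hIj j hj).trans (by linarith)) (by positivity)
      _ = ε / 2 := by field_simp
  linarith

theorem isApprox_expSums {f : Plane → ℝ} {n : ℕ} (hf : ContDiff ℝ n f) :
    IsApprox n expSums f := by
  refine ⟨hf, fun R ε hε => ?_⟩
  -- Cutting off outside a large ball does not change `f` near the points of interest.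
  let b : ContDiffBump (0 : Plane) :=
    { rIn := |R| + 1, rOut := |R| + 2, rIn_pos := by positivity, rIn_lt_rOut := by linarith }
  have cb : ContDiff ℝ n (fun x => b x * f x) := b.contDiff.mul hf
  have hbc : HasCompactSupport fun x => b x * f x := b.hasCompactSupport.mul_right
  obtain ⟨g, hg, cg, h⟩ := (isApprox_expSums_of_hasCompactSupport cb hbc).2 R ε hε
  refine ⟨g, hg, cg, fun j hj x hx => ?_⟩
  have hev : (f - g) =ᶠ[𝓝 x] ((fun x => b x * f x) - g) := by
    have hxb : x ∈ Metric.ball (0 : Plane) (|R| + 1) := by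
      rw [mem_ball_zero_iff]
      linarith [le_abs_self R]
    filter_upwards [Metric.isOpen_ball.mem_nhds hxb] with y hy
    simp [b.one_of_mem_closedBall (Metric.ball_subset_closedBall hy)]
  rw [(hev.iteratedFDeriv ℝ j).self_of_nhds]
  exact h j hj x hx

/-! ### Density of networks in the plane -/

/-- The span of the functions `x ↦ φ (⟪a, x⟫ + c)`. -/
def planeNets (φ : ℝ → ℝ) : Submodule ℝ (Plane → ℝ) :=
  Submodule.span ℝ {f | ∃ (a : Plane) (c : ℝ), f = fun x => φ (inner ℝ a x + c)}

theorem comp_inner_mem_planeNets {φ H : ℝ → ℝ} (hH : H ∈ lineNets φ) (a : Plane) :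
    (fun x => H (inner ℝ a x)) ∈ planeNets φ := by
  induction hH using Submodule.span_induction with
  | mem H hH =>
    obtain ⟨b, c, rfl⟩ := hH
    exact Submodule.subset_span ⟨b • a, c, by funext x; rw [real_inner_smul_left]⟩
  | zero => exact Submodule.zero_mem _
  | add F G _ _ hF hG => exact Submodule.add_mem _ hF hG
  | smul b F _ hF => exact Submodule.smul_mem _ b hF

theorem IsActivation.isApprox_exp {φ : ℝ → ℝ} (hφ : IsActivation φ) (a : Plane) :
    IsApprox 2 (planeNets φ) fun x => Real.exp (inner ℝ a x) := by
  have cin : ContDiff ℝ 2 fun x : Plane => (inner ℝ a x : ℝ) := contDiff_const.inner ℝ contDiff_id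
  refine ⟨Real.contDiff_exp.comp cin, fun R ε hε => ?_⟩
  obtain ⟨H, hH, h⟩ := hφ.exists_lineNets_exp (S := ‖a‖ * |R|) (by positivity)
    (ε := ε / (1 + ‖a‖) ^ 2) (by positivity)
  have cH := lineNets_contDiff hφ.contDiff hH
  refine ⟨_, comp_inner_mem_planeNets hH a, cH.comp cin, fun j hj x hx => ?_⟩
  have hj' : (j : WithTop ℕ∞) ≤ 2 := by exact_mod_cast hj
  have cF : ContDiff ℝ 2 fun s => Real.exp s - H s := Real.contDiff_exp.sub cH
  have e : ((fun x => Real.exp (inner ℝ a x)) - fun x => H (inner ℝ a x))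
      = (fun s => Real.exp s - H s) ∘ (innerSL ℝ a) := by
    funext x
    simp
  have hmem : innerSL ℝ a x ∈ Set.Icc (-(‖a‖ * |R|)) (‖a‖ * |R|) := by
    rw [Set.mem_Icc, ← abs_le, innerSL_apply_apply]
    exact (abs_real_inner_le_norm a x).trans
      (mul_le_mul_of_nonneg_left (hx.trans (le_abs_self R)) (norm_nonneg a))
  rw [e, (innerSL ℝ a).iteratedFDeriv_comp_right cF x hj']
  refine (ContinuousMultilinearMap.norm_compContinuousLinearMap_le _ _).trans ?_
  rw [norm_iteratedFDeriv_eq_norm_iteratedDeriv, Finset.prod_const, Finset.card_univ,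
    Fintype.card_fin, innerSL_apply_norm, Real.norm_eq_abs]
  have hpow : ‖a‖ ^ j ≤ (1 + ‖a‖) ^ 2 :=
    (pow_le_pow_left₀ (norm_nonneg a) (by linarith) j).trans
      (pow_le_pow_right₀ (by linarith [norm_nonneg a]) hj)
  calc |iteratedDeriv j (fun s => Real.exp s - H s) (innerSL ℝ a x)| * ‖a‖ ^ j
      ≤ ε / (1 + ‖a‖) ^ 2 * (1 + ‖a‖) ^ 2 :=
        mul_le_mul (h _ hmem j hj) hpow (by positivity) (by positivity)
    _ = ε := by field_simp

theorem IsActivation.isApprox {φ : ℝ → ℝ} (hφ : IsActivation φ) {n : ℕ} (hn : n ≤ 2)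
    {f : Plane → ℝ} (hf : ContDiff ℝ n f) : IsApprox n (planeNets φ) f := by
  refine (isApprox_expSums hf).trans fun g hg => IsApprox.mono hn ?_
  induction hg using Submodule.span_induction with
  | mem g hg =>
    obtain ⟨a, rfl⟩ := hg
    exact hφ.isApprox_exp a
  | zero => exact IsApprox.of_mem (Submodule.zero_mem _) contDiff_const
  | add f g _ _ hf hg => exact hf.add hg
  | smul a f _ hf => exact hf.smul a

theorem scalarNet_add {φ : ℝ → ℝ} {m m' : ℕ} {f g : Plane → ℝ} (hf : f ∈ scalarNet φ m)
    (hg : g ∈ scalarNet φ m') : f + g ∈ scalarNet φ (m + m') := by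
  obtain ⟨β, c, σ, hf⟩ := hf
  obtain ⟨β', c', σ', hg⟩ := hg
  refine ⟨Fin.append β β', Fin.append c c', fun j => Fin.append (σ j) (σ' j), fun x => ?_⟩
  rw [Fin.sum_univ_add]
  simp only [Fin.append_left, Fin.append_right]
  rw [Pi.add_apply, hf, hg]

theorem zero_mem_scalarNet (φ : ℝ → ℝ) (m : ℕ) : (0 : Plane → ℝ) ∈ scalarNet φ m :=
  ⟨0, 0, 0, fun x => by simp⟩

theorem exists_mem_scalarNet {φ : ℝ → ℝ} {f : Plane → ℝ} (hf : f ∈ planeNets φ) :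
    ∃ m, f ∈ scalarNet φ m := by
  induction hf using Submodule.span_induction with
  | mem f hf =>
    obtain ⟨a, c, rfl⟩ := hf
    refine ⟨1, fun _ => 1, fun _ => c, fun j _ => a j, fun x => ?_⟩
    simp [PiLp.inner_apply, Fin.sum_univ_two, mul_comm]
  | zero => exact ⟨0, zero_mem_scalarNet φ 0⟩
  | add f g _ _ hf hg =>
    obtain ⟨m, hf⟩ := hf
    obtain ⟨m', hg⟩ := hg
    exact ⟨_, scalarNet_add hf hg⟩
  | smul a f _ hf =>
    obtain ⟨m, β, c, σ, hf⟩ := hf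
    refine ⟨m, fun i => a * β i, c, σ, fun x => ?_⟩
    rw [Pi.smul_apply, hf, smul_eq_mul, Finset.mul_sum]
    simp only [mul_assoc]

theorem IsActivation.exists_scalarNets {φ : ℝ → ℝ} (hφ : IsActivation φ) {n : ℕ} (hn : n ≤ 2)
    {f : Plane → ℝ} (hf : ContDiff ℝ n f) (R : ℝ) {ε : ℝ} (hε : 0 < ε) :
    ∃ g ∈ scalarNets φ, ContDiff ℝ n g ∧
      ∀ j ≤ n, ∀ x, ‖x‖ ≤ R → ‖iteratedFDeriv ℝ j (f - g) x‖ ≤ ε := by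
  obtain ⟨g, hg, cg, h⟩ := (hφ.isApprox hn hf).2 R ε hε
  exact ⟨g, Set.mem_iUnion.2 (exists_mem_scalarNet hg), cg, h⟩

/-- The components are approximated separately; the two networks are padded with units of weight `0`
to the same size. -/
theorem IsActivation.exists_vectorNets {φ : ℝ → ℝ} (hφ : IsActivation φ) {n : ℕ} (hn : n ≤ 2)
    {u : Plane → Plane} (hu : ContDiff ℝ n u) (R : ℝ) {ε : ℝ} (hε : 0 < ε) :
    ∃ U ∈ vectorNets φ, ContDiff ℝ n U ∧
      ∀ j ≤ n, ∀ x, ‖x‖ ≤ R → ‖iteratedFDeriv ℝ j (u - U) x‖ ≤ ε := by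
  have hcomp : ∀ i : Fin 2, ContDiff ℝ n fun x => u x i := fun i => contDiff_euclidean.1 hu i
  choose g hg cg h using fun i => (hφ.isApprox hn (hcomp i)).2 R (ε / 2) (half_pos hε)
  obtain ⟨m₀, h₀⟩ := exists_mem_scalarNet (hg 0)
  obtain ⟨m₁, h₁⟩ := exists_mem_scalarNet (hg 1)
  have cU : ContDiff ℝ n fun x => (WithLp.toLp 2 fun i => g i x : Plane) :=
    contDiff_euclidean.2 fun i => cg i
  refine ⟨fun x => WithLp.toLp 2 fun i => g i x, Set.mem_iUnion.2 ⟨m₀ + m₁, fun k => ?_⟩, cU,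
    fun j hj x hx => ?_⟩
  · fin_cases k
    · simpa using scalarNet_add h₀ (zero_mem_scalarNet φ m₁)
    · simpa using scalarNet_add (zero_mem_scalarNet φ m₀) h₁
  · have hj' : (j : WithTop ℕ∞) ≤ n := by exact_mod_cast hj
    let L : Fin 2 → (ℝ →L[ℝ] Plane) := fun i =>
      ContinuousLinearMap.toSpanSingleton ℝ (EuclideanSpace.single i (1 : ℝ))
    have hL : ∀ i, ‖L i‖ = 1 := fun i => by
      simp [L, ContinuousLinearMap.norm_toSpanSingleton]
    have cV : ∀ i, ContDiff ℝ j ((fun x => u x i) - g i) := fun i =>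
      ((hcomp i).sub (cg i)).of_le hj'
    have cLV : ∀ i, ContDiff ℝ j (L i ∘ ((fun x => u x i) - g i)) := fun i =>
      (L i).contDiff.comp (cV i)
    have e : (u - fun x => WithLp.toLp 2 fun i => g i x)
        = (L 0 ∘ ((fun x => u x 0) - g 0)) + (L 1 ∘ ((fun x => u x 1) - g 1)) := by
      funext x
      ext i
      fin_cases i <;> simp [L]
    have hb : ∀ i, ‖iteratedFDeriv ℝ j (L i ∘ ((fun x => u x i) - g i)) x‖ ≤ ε / 2 := fun i => by
      have := (L i).norm_iteratedFDeriv_comp_left (x := x) (cV i).contDiffAt le_rfl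
      rw [hL, one_mul] at this
      exact this.trans (h i j hj x hx)
    rw [e, iteratedFDeriv_add_apply (cLV 0).contDiffAt (cLV 1).contDiffAt]
    exact (norm_add_le _ _).trans (by linarith [hb 0, hb 1])

/-! ### Pointwise estimates of the residuals -/

theorem norm_sub_le_of_iteratedFDeriv {F : Type*} [NormedAddCommGroup F] [NormedSpace ℝ F]
    {u U : Plane → F} {x : Plane} {δ : ℝ} (h : ‖iteratedFDeriv ℝ 0 (u - U) x‖ ≤ δ) :
    ‖U x - u x‖ ≤ δ := by
  rw [norm_iteratedFDeriv_zero] at h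
  rwa [norm_sub_rev]

theorem norm_fderiv_sub_le_of_iteratedFDeriv {F : Type*} [NormedAddCommGroup F] [NormedSpace ℝ F]
    {u U : Plane → F} (hu : ContDiff ℝ 1 u) (hU : ContDiff ℝ 1 U) {x : Plane} {δ : ℝ}
    (h : ‖iteratedFDeriv ℝ 1 (u - U) x‖ ≤ δ) : ‖fderiv ℝ U x - fderiv ℝ u x‖ ≤ δ := by
  rwa [norm_iteratedFDeriv_one, fderiv_sub (hu.differentiable one_ne_zero x)
    (hU.differentiable one_ne_zero x), norm_sub_rev] at h

theorem norm_laplacian_sub_le_of_iteratedFDeriv {u U : Plane → Plane} (hu : ContDiff ℝ 2 u)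
    (hU : ContDiff ℝ 2 U) {x : Plane} {δ : ℝ} (h : ‖iteratedFDeriv ℝ 2 (u - U) x‖ ≤ δ) :
    ‖Laplacian.laplacian U x - Laplacian.laplacian u x‖ ≤ 2 * δ := by
  have hs := iteratedFDeriv_sub_apply (x := x) (i := 2) (𝕜 := ℝ)
    (by exact_mod_cast hu.contDiffAt) (by exact_mod_cast hU.contDiffAt)
  rw [hs] at h
  have e : Laplacian.laplacian u x - Laplacian.laplacian U x
      = ∑ i : Fin 2, (iteratedFDeriv ℝ 2 u x - iteratedFDeriv ℝ 2 U x)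
        ![EuclideanSpace.basisFun (Fin 2) ℝ i, EuclideanSpace.basisFun (Fin 2) ℝ i] := by
    simp only [InnerProductSpace.laplacian_eq_iteratedFDeriv_orthonormalBasis _
      (EuclideanSpace.basisFun (Fin 2) ℝ), sub_apply,
      Finset.sum_sub_distrib]
  rw [norm_sub_rev, e]
  refine (norm_sum_le _ _).trans ?_
  have hb : ∀ i : Fin 2, ‖(iteratedFDeriv ℝ 2 u x - iteratedFDeriv ℝ 2 U x)
      ![EuclideanSpace.basisFun (Fin 2) ℝ i, EuclideanSpace.basisFun (Fin 2) ℝ i]‖ ≤ δ := by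
    intro i
    refine (ContinuousMultilinearMap.le_opNorm _ _).trans ?_
    simpa [Fin.prod_univ_two] using h
  rw [Fin.sum_univ_two]
  linarith [hb 0, hb 1]

theorem abs_divergence_sub_le {u U : Plane → Plane} {x : Plane} {δ : ℝ}
    (h : ‖fderiv ℝ U x - fderiv ℝ u x‖ ≤ δ) : |divergence U x - divergence u x| ≤ 2 * δ := by
  have hb : ∀ i : Fin 2, |((fderiv ℝ U x - fderiv ℝ u x) (EuclideanSpace.single i 1)) i| ≤ δ := by
    intro i
    have h1 := PiLp.norm_apply_le ((fderiv ℝ U x - fderiv ℝ u x) (EuclideanSpace.single i 1)) i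
    have h2 := (fderiv ℝ U x - fderiv ℝ u x).le_opNorm (EuclideanSpace.single i 1)
    rw [PiLp.norm_single, norm_one, mul_one] at h2
    exact h1.trans (h2.trans h)
  have e : divergence U x - divergence u x
      = ∑ i : Fin 2, ((fderiv ℝ U x - fderiv ℝ u x) (EuclideanSpace.single i 1)) i := by
    simp [divergence]
  rw [e]
  refine (Finset.abs_sum_le_sum_abs _ _).trans ?_
  rw [Fin.sum_univ_two]
  linarith [hb 0, hb 1]

theorem norm_gradient_sub_le {p P : Plane → ℝ} {x : Plane} {δ : ℝ}
    (h : ‖fderiv ℝ P x - fderiv ℝ p x‖ ≤ δ) : ‖gradient P x - gradient p x‖ ≤ δ := by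
  rw [gradient, gradient, ← map_sub, LinearIsometryEquiv.norm_map]
  exact h

theorem matVec_sub (A : Matrix (Fin 2) (Fin 2) ℝ) (v w : Plane) :
    matVec A (v - w) = matVec A v - matVec A w := by
  rw [matVec, WithLp.ofLp_sub, Matrix.mulVec_sub, WithLp.toLp_sub]
  rfl

/-- The inverse of a matrix with lower bound `k₀` in the sense of quadratic forms has norm at most
`k₀⁻¹`. In particular the matrix is invertible, so that `A⁻¹` is its actual inverse. -/
theorem norm_matVec_inv_le {A : Matrix (Fin 2) (Fin 2) ℝ} {k₀ : ℝ} (hk : 0 < k₀)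
    (hA : ∀ ξ : Plane, k₀ * ‖ξ‖ ^ 2 ≤ inner ℝ ξ (matVec A ξ)) (v : Plane) :
    ‖matVec A⁻¹ v‖ ≤ k₀⁻¹ * ‖v‖ := by
  have hinj : Function.Injective A.mulVec := by
    intro ξ η h
    have h0 : A.mulVec (ξ - η) = 0 := by rw [Matrix.mulVec_sub, sub_eq_zero]; exact h
    have h1 := hA (WithLp.toLp 2 (ξ - η))
    rw [matVec, h0, WithLp.toLp_zero, inner_zero_right] at h1
    have h2 : ‖(WithLp.toLp 2 (ξ - η) : Plane)‖ ^ 2 = 0 :=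
      le_antisymm (by by_contra! hc; nlinarith) (sq_nonneg _)
    have h3 : (WithLp.toLp 2 (ξ - η) : Plane) = 0 :=
      norm_eq_zero.1 (pow_eq_zero_iff two_ne_zero |>.1 h2)
    exact sub_eq_zero.1 ((WithLp.toLp_eq_zero 2).1 h3)
  have hunit : IsUnit A := Matrix.mulVec_injective_iff_isUnit.1 hinj
  have hdet : IsUnit A.det := (Matrix.isUnit_iff_isUnit_det A).1 hunit
  have e : matVec A (matVec A⁻¹ v) = v := by
    rw [matVec, matVec, Matrix.mulVec_mulVec, Matrix.mul_nonsing_inv A hdet, Matrix.one_mulVec]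
  have h1 := hA (matVec A⁻¹ v)
  rw [e] at h1
  have h2 := h1.trans (real_inner_le_norm _ _)
  rcases (norm_nonneg (matVec A⁻¹ v)).eq_or_lt with h0 | h0
  · rw [← h0]; positivity
  · rw [inv_mul_eq_div, le_div_iff₀ hk]
    have h3 : ‖matVec A⁻¹ v‖ * (‖matVec A⁻¹ v‖ * k₀) ≤ ‖matVec A⁻¹ v‖ * ‖v‖ := by
      nlinarith
    exact le_of_mul_le_mul_left h3 h0

theorem norm_norm_smul_sub_le (v w : Plane) :
    ‖‖v‖ • v - ‖w‖ • w‖ ≤ (‖v - w‖ + 2 * ‖w‖) * ‖v - w‖ := by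
  have e : ‖v‖ • v - ‖w‖ • w = ‖v‖ • (v - w) + (‖v‖ - ‖w‖) • w := by module
  have h1 : ‖v‖ ≤ ‖v - w‖ + ‖w‖ := by
    have := norm_add_le (v - w) w
    rwa [sub_add_cancel] at this
  have h2 : |‖v‖ - ‖w‖| ≤ ‖v - w‖ := abs_norm_sub_norm_le v w
  rw [e]
  refine (norm_add_le _ _).trans ?_
  rw [norm_smul, norm_smul, norm_norm, Real.norm_eq_abs]
  nlinarith [mul_le_mul_of_nonneg_right h1 (norm_nonneg (v - w)),
    mul_le_mul_of_nonneg_right h2 (norm_nonneg w)]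

namespace Data

variable (D : Data) {ν G : ℝ} {uS uD : Plane → Plane} {pS pD : Plane → ℝ}

theorem norm_stokesRes_le (h : D.IsClassicalSolution ν G uS uD pS pD) (hν : 0 < ν)
    {US : Plane → Plane} {PS : Plane → ℝ} {x : Plane} (hx : x ∈ D.ΩS) {δ : ℝ}
    (h1 : ‖Laplacian.laplacian US x - Laplacian.laplacian uS x‖ ≤ 2 * δ)
    (h2 : ‖gradient PS x - gradient pS x‖ ≤ δ) : ‖D.stokesRes ν US PS x‖ ≤ (2 * ν + 1) * δ := by
  have e : D.stokesRes ν US PS x = ν • (Laplacian.laplacian US x - Laplacian.laplacian uS x)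
      - (gradient PS x - gradient pS x) := by
    rw [stokesRes, ← h.stokes_momentum x hx]
    module
  rw [e]
  refine (norm_sub_le _ _).trans ?_
  rw [norm_smul, Real.norm_of_nonneg hν.le]
  nlinarith

theorem norm_darcyRes_le (h : D.IsClassicalSolution ν G uS uD pS pD) {k₀ M : ℝ} (hk : 0 < k₀)
    {UD : Plane → Plane} {PD : Plane → ℝ} {x : Plane} (hx : x ∈ D.ΩD)
    (hK : ∀ ξ : Plane, k₀ * ‖ξ‖ ^ 2 ≤ inner ℝ ξ (matVec (D.K x) ξ)) (hM : ‖uD x‖ ≤ M)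
    {δ : ℝ} (hδ : δ ≤ 1) (h1 : ‖UD x - uD x‖ ≤ δ) (h2 : ‖gradient PD x - gradient pD x‖ ≤ δ) :
    ‖D.darcyRes UD PD x‖ ≤ (D.μ / D.ρ * k₀⁻¹ + D.β / D.ρ * (1 + 2 * M) + 1) * δ := by
  have hμ : 0 < D.μ / D.ρ := div_pos D.μ_pos D.ρ_pos
  have hβ : 0 < D.β / D.ρ := div_pos D.β_pos D.ρ_pos
  have e : D.darcyRes UD PD x = (D.μ / D.ρ) • matVec (D.K x)⁻¹ (UD x - uD x)
      + (D.β / D.ρ) • (‖UD x‖ • UD x - ‖uD x‖ • uD x) + (gradient PD x - gradient pD x) := by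
    rw [darcyRes, ← h.darcy_law x hx, matVec_sub]
    module
  have b1 : ‖matVec (D.K x)⁻¹ (UD x - uD x)‖ ≤ k₀⁻¹ * δ :=
    (norm_matVec_inv_le hk hK _).trans (mul_le_mul_of_nonneg_left h1 (by positivity))
  have b2 : ‖‖UD x‖ • UD x - ‖uD x‖ • uD x‖ ≤ (1 + 2 * M) * δ :=
    (norm_norm_smul_sub_le _ _).trans (mul_le_mul (by linarith) h1 (norm_nonneg _)
      (by linarith [norm_nonneg (uD x)]))
  rw [e]
  refine (norm_add₃_le).trans ?_
  rw [norm_smul, norm_smul, Real.norm_of_nonneg hμ.le, Real.norm_of_nonneg hβ.le]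
  have c1 := mul_le_mul_of_nonneg_left b1 hμ.le
  have c2 := mul_le_mul_of_nonneg_left b2 hβ.le
  linarith

theorem abs_normalVelRes_le (h : D.IsClassicalSolution ν G uS uD pS pD) {US UD : Plane → Plane}
    {x n : Plane} (hx : x ∈ D.Γ) (hn : IsOuterUnitNormal D.ΩS x n) {δ : ℝ}
    (h1 : ‖US x - uS x‖ ≤ δ) (h2 : ‖UD x - uD x‖ ≤ δ) : |normalVelRes US UD n x| ≤ 2 * δ := by
  have e : normalVelRes US UD n x = inner ℝ (US x - uS x) n - inner ℝ (UD x - uD x) n := by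
    rw [normalVelRes, inner_sub_left, inner_sub_left, h.normal_velocity x hx n hn]
    ring
  have b1 := abs_real_inner_le_norm (US x - uS x) n
  have b2 := abs_real_inner_le_norm (UD x - uD x) n
  rw [hn.1, mul_one] at b1 b2
  rw [e]
  exact (abs_sub _ _).trans (by linarith)

theorem abs_inner_fderiv_sub_le {u U : Plane → Plane} {x m n : Plane} (hm : ‖m‖ = 1) (hn : ‖n‖ = 1)
    {δ : ℝ} (h : ‖fderiv ℝ U x - fderiv ℝ u x‖ ≤ δ) :
    |inner ℝ m (fderiv ℝ U x n) - inner ℝ m (fderiv ℝ u x n)| ≤ δ := by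
  rw [← inner_sub_right, ← sub_apply]
  refine (abs_real_inner_le_norm _ _).trans ?_
  rw [hm, one_mul]
  have := (fderiv ℝ U x - fderiv ℝ u x).le_opNorm n
  rw [hn, mul_one] at this
  exact this.trans h

theorem abs_normalForceRes_le (h : D.IsClassicalSolution ν G uS uD pS pD) (hν : 0 < ν)
    {US : Plane → Plane} {PS PD : Plane → ℝ} {x n : Plane} (hx : x ∈ D.Γ)
    (hn : IsOuterUnitNormal D.ΩS x n) {δ : ℝ} (h1 : ‖fderiv ℝ US x - fderiv ℝ uS x‖ ≤ δ)
    (h2 : |PS x - pS x| ≤ δ) (h3 : |PD x - pD x| ≤ δ) :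
    |normalForceRes ν US PS PD n x| ≤ (ν + 2) * δ := by
  have e : normalForceRes ν US PS PD n x = (PS x - pS x)
      - ν * (inner ℝ n (fderiv ℝ US x n) - inner ℝ n (fderiv ℝ uS x n)) - (PD x - pD x) := by
    rw [normalForceRes]
    linarith [h.normal_force x hx n hn]
  have b := abs_inner_fderiv_sub_le hn.1 hn.1 h1
  rw [abs_le] at b h2 h3
  rw [e, abs_le]
  constructor <;> nlinarith

theorem abs_bjsRes_le (h : D.IsClassicalSolution ν G uS uD pS pD) (hν : 0 < ν) (hG : 0 < G)
    {US : Plane → Plane} {x n : Plane} (hx : x ∈ D.Γ)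
    (hn : IsOuterUnitNormal D.ΩS x n) {δ : ℝ} (h1 : ‖fderiv ℝ US x - fderiv ℝ uS x‖ ≤ δ)
    (h2 : ‖US x - uS x‖ ≤ δ) : |bjsRes ν G US n (rot n) x| ≤ (ν + G) * δ := by
  have hr : ‖rot n‖ = 1 := (norm_rot n).trans hn.1
  have e : bjsRes ν G US n (rot n) x
      = -ν * (inner ℝ (rot n) (fderiv ℝ US x n) - inner ℝ (rot n) (fderiv ℝ uS x n))
        - G * inner ℝ (US x - uS x) (rot n) := by
    rw [bjsRes, inner_sub_left]
    linarith [h.beavers_joseph_saffman x hx n hn]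
  have b := abs_inner_fderiv_sub_le hr hn.1 h1
  have b2 := abs_real_inner_le_norm (US x - uS x) (rot n)
  rw [hr, mul_one] at b2
  replace b2 := b2.trans h2
  rw [abs_le] at b b2
  rw [e, abs_le]
  constructor <;> nlinarith

/-! ### Estimate of the loss -/

/-- The interface has a normal at almost every point. -/
theorem ae_isOuterUnitNormal :
    ∀ᵐ x ∂(μH[1].restrict D.Γ), IsOuterUnitNormal D.ΩS x (D.nS x) := by
  obtain ⟨S, hS, h⟩ := D.polygonalS.exists_finite_isOuterUnitNormal
  have hΓ : MeasurableSet D.Γ := (isClosed_frontier.inter isClosed_frontier).measurableSet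
  have : NullSingletonClass (μH[1] : Measure Plane) :=
    Measure.nullSingletonClass_hausdorff Plane one_pos
  have hS0 : (μH[1] : Measure Plane).restrict D.Γ S = 0 :=
    Measure.restrict_le_self.absolutelyContinuous (hS.measure_zero _)
  filter_upwards [ae_restrict_mem hΓ, measure_eq_zero_iff_ae_notMem.1 hS0] with x hx hxS
  obtain ⟨n, hn⟩ := h x hx.1 hxS
  rw [nS, outerNormal_eq hn]
  exact hn

end Data

theorem sqNorm_le {F : Type*} [NormedAddCommGroup F] {m : Measure Plane} {Y Z : Set Plane}
    (hYZ : Y ⊆ Z) {w : Plane → ℝ} {f : Plane → F} {B : ℝ}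
    (hf : ∀ᵐ x ∂(m.restrict Y), ‖f x‖ ≤ B) :
    sqNorm m Y w f ≤ ENNReal.ofReal (B ^ 2) * ∫⁻ x in Z, ENNReal.ofReal (w x) ∂m := by
  calc sqNorm m Y w f ≤ ∫⁻ x in Y, ENNReal.ofReal (B ^ 2) * ENNReal.ofReal (w x) ∂m := by
        refine lintegral_mono_ae ?_
        filter_upwards [hf] with x hx
        rw [ENNReal.ofReal_mul (sq_nonneg _)]
        gcongr
    _ = ENNReal.ofReal (B ^ 2) * ∫⁻ x in Y, ENNReal.ofReal (w x) ∂m :=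
        lintegral_const_mul' _ _ ENNReal.ofReal_ne_top
    _ ≤ _ := by
        gcongr

namespace Data

variable (D : Data)

/-- The total mass of the three densities. -/
def mass : ℝ≥0∞ :=
  (∫⁻ x in D.ΩS ∪ D.ΩD, ENNReal.ofReal (D.ω₁ x))
    + (∫⁻ x in (frontier D.ΩS ∪ frontier D.ΩD) \ (frontier D.ΩS ∩ frontier D.ΩD),
        ENNReal.ofReal (D.ω₂ x) ∂μH[1])
    + ∫⁻ x in frontier D.ΩS ∩ frontier D.ΩD, ENNReal.ofReal (D.ω₃ x) ∂μH[1]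

theorem mass_ne_top : D.mass ≠ ⊤ := by
  rw [mass, ENNReal.add_ne_top, ENNReal.add_ne_top]
  exact ⟨⟨D.ω₁_integrable.lintegral_lt_top.ne, D.ω₂_integrable.lintegral_lt_top.ne⟩,
    D.ω₃_integrable.lintegral_lt_top.ne⟩

/-- If all nine residuals are at most `B`, then the loss is at most `9 B²` times the total mass of
the densities. -/
theorem loss_le {ν G B : ℝ} {US UD : Plane → Plane} {PS PD : Plane → ℝ}
    (h1 : ∀ x ∈ D.ΩS, ‖D.stokesRes ν US PS x‖ ≤ B) (h2 : ∀ x ∈ D.ΩS, ‖divergence US x‖ ≤ B)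
    (h3 : ∀ x ∈ D.ΓS, ‖US x‖ ≤ B) (h4 : ∀ x ∈ D.ΩD, ‖D.fD x - divergence UD x‖ ≤ B)
    (h5 : ∀ x ∈ D.ΩD, ‖D.darcyRes UD PD x‖ ≤ B) (h6 : ∀ x ∈ D.ΓD, ‖PD x‖ ≤ B)
    (h7 : ∀ᵐ x ∂(μH[1].restrict D.Γ), ‖normalVelRes US UD (D.nS x) x‖ ≤ B)
    (h8 : ∀ᵐ x ∂(μH[1].restrict D.Γ), ‖normalForceRes ν US PS PD (D.nS x) x‖ ≤ B)
    (h9 : ∀ᵐ x ∂(μH[1].restrict D.Γ), ‖bjsRes ν G US (D.nS x) (D.tS x) x‖ ≤ B) :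
    D.loss ν G US UD PS PD ≤ 9 * (ENNReal.ofReal (B ^ 2) * D.mass) := by
  have mS : MeasurableSet D.ΩS := D.polygonalS.isOpen.measurableSet
  have mD : MeasurableSet D.ΩD := D.polygonalD.isOpen.measurableSet
  have mΓ : MeasurableSet D.Γ := (isClosed_frontier.inter isClosed_frontier).measurableSet
  have mΓS : MeasurableSet D.ΓS := isClosed_frontier.measurableSet.diff mΓ
  have mΓD : MeasurableSet D.ΓD := isClosed_frontier.measurableSet.diff mΓ
  have i1 : (∫⁻ x in D.ΩS ∪ D.ΩD, ENNReal.ofReal (D.ω₁ x)) ≤ D.mass :=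
    le_self_add.trans le_self_add
  have i2 : (∫⁻ x in (frontier D.ΩS ∪ frontier D.ΩD) \ (frontier D.ΩS ∩ frontier D.ΩD),
      ENNReal.ofReal (D.ω₂ x) ∂μH[1]) ≤ D.mass := le_add_self.trans le_self_add
  have i3 : (∫⁻ x in frontier D.ΩS ∩ frontier D.ΩD, ENNReal.ofReal (D.ω₃ x) ∂μH[1]) ≤ D.mass :=
    le_add_self
  have hΓS : D.ΓS ⊆ (frontier D.ΩS ∪ frontier D.ΩD) \ (frontier D.ΩS ∩ frontier D.ΩD) :=
    Set.sdiff_subset_sdiff_left Set.subset_union_left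
  have hΓD : D.ΓD ⊆ (frontier D.ΩS ∪ frontier D.ΩD) \ (frontier D.ΩS ∩ frontier D.ΩD) :=
    Set.sdiff_subset_sdiff_left Set.subset_union_right
  have a1 := (sqNorm_le (w := D.ω₁) Set.subset_union_left (ae_restrict_of_forall_mem
    (μ := volume) mS h1)).trans (mul_le_mul_right i1 _)
  have a2 := (sqNorm_le (w := D.ω₁) Set.subset_union_left (ae_restrict_of_forall_mem
    (μ := volume) mS h2)).trans (mul_le_mul_right i1 _)
  have a3 := (sqNorm_le (w := D.ω₂) hΓS (ae_restrict_of_forall_mem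
    (μ := μH[1]) mΓS h3)).trans (mul_le_mul_right i2 _)
  have a4 := (sqNorm_le (w := D.ω₁) Set.subset_union_right (ae_restrict_of_forall_mem
    (μ := volume) mD h4)).trans (mul_le_mul_right i1 _)
  have a5 := (sqNorm_le (w := D.ω₁) Set.subset_union_right (ae_restrict_of_forall_mem
    (μ := volume) mD h5)).trans (mul_le_mul_right i1 _)
  have a6 := (sqNorm_le (w := D.ω₂) hΓD (ae_restrict_of_forall_mem
    (μ := μH[1]) mΓD h6)).trans (mul_le_mul_right i2 _)
  have a7 := (sqNorm_le (w := D.ω₃) subset_rfl h7).trans (mul_le_mul_right i3 _)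
  have a8 := (sqNorm_le (w := D.ω₃) subset_rfl h8).trans (mul_le_mul_right i3 _)
  have a9 := (sqNorm_le (w := D.ω₃) subset_rfl h9).trans (mul_le_mul_right i3 _)
  rw [loss, lossS, lossD, lossΓ]
  refine (add_le_add (add_le_add (add_le_add (add_le_add a1 a2) a3)
    (add_le_add (add_le_add a4 a5) a6)) (add_le_add (add_le_add a7 a8) a9)).trans (le_of_eq ?_)
  ring

/-- The closures of the two domains lie in a common ball. -/
theorem exists_norm_le : ∃ R : ℝ, ∀ x ∈ closure D.ΩS ∪ closure D.ΩD, ‖x‖ ≤ R :=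
  (D.polygonalS.bounded.closure.union D.polygonalD.bounded.closure).exists_norm_le

/-- Networks that are `C²`-close to an exact solution make all residuals small, hence the loss. -/
theorem exists_loss_le {ν G : ℝ} (hν : 0 < ν) (hG : 0 < G) {φ ζ ψ γ : ℝ → ℝ}
    (hφ : IsActivation φ) (hζ : IsActivation ζ) (hψ : IsActivation ψ) (hγ : IsActivation γ)
    {uS uD : Plane → Plane} {pS pD : Plane → ℝ} (h : D.IsClassicalSolution ν G uS uD pS pD)
    {B : ℝ} (hB : 0 < B) :
    ∃ US ∈ vectorNets φ, ∃ UD ∈ vectorNets ζ, ∃ PS ∈ scalarNets ψ, ∃ PD ∈ scalarNets γ,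
      D.loss ν G US UD PS PD ≤ 9 * (ENNReal.ofReal (B ^ 2) * D.mass) := by
  obtain ⟨R, hR⟩ := D.exists_norm_le
  obtain ⟨k₀, hk, hK⟩ := D.K_posDef
  obtain ⟨M, hM⟩ := (isCompact_closedBall (0 : Plane) R).exists_bound_of_continuousOn
    h.contDiff_uD.continuous.continuousOn
  have hμ : 0 < D.μ / D.ρ := div_pos D.μ_pos D.ρ_pos
  have hβ : 0 < D.β / D.ρ := div_pos D.β_pos D.ρ_pos
  -- The sum of the constants in the estimates of the residuals.
  set c := (2 * ν + 3) + (D.μ / D.ρ * k₀⁻¹ + D.β / D.ρ * (1 + 2 * |M|) + 1) + (ν + G) with hc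
  have hc₁ : 0 < D.μ / D.ρ * k₀⁻¹ := by positivity
  have hc₂ : 0 < D.β / D.ρ * (1 + 2 * |M|) := by positivity
  have hc0 : 0 < c := by positivity
  set δ := min 1 (B / c) with hδ
  have hδ0 : 0 < δ := lt_min one_pos (by positivity)
  have hδ1 : δ ≤ 1 := min_le_left _ _
  have hδB : ∀ k : ℝ, k ≤ c → k * δ ≤ B := fun k hk => by
    calc k * δ ≤ c * δ := mul_le_mul_of_nonneg_right hk hδ0.le
      _ ≤ c * (B / c) := mul_le_mul_of_nonneg_left (min_le_right _ _) hc0.le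
      _ = B := by field_simp
  obtain ⟨US, hUS, cUS, aUS⟩ := hφ.exists_vectorNets le_rfl h.contDiff_uS R hδ0
  obtain ⟨UD, hUD, cUD, aUD⟩ := hζ.exists_vectorNets le_rfl h.contDiff_uD R hδ0
  obtain ⟨PS, hPS, cPS, aPS⟩ := hψ.exists_scalarNets one_le_two
    (by exact_mod_cast h.contDiff_pS) R hδ0
  obtain ⟨PD, hPD, cPD, aPD⟩ := hγ.exists_scalarNets one_le_two
    (by exact_mod_cast h.contDiff_pD) R hδ0
  have inS : ∀ x ∈ D.ΩS, ‖x‖ ≤ R := fun x hx => hR x (Or.inl (subset_closure hx))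
  have inD : ∀ x ∈ D.ΩD, ‖x‖ ≤ R := fun x hx => hR x (Or.inr (subset_closure hx))
  have inΓ : ∀ x ∈ D.Γ, ‖x‖ ≤ R := fun x hx => hR x (Or.inl hx.1.1)
  have dUS : ∀ x, ‖x‖ ≤ R → ‖fderiv ℝ US x - fderiv ℝ uS x‖ ≤ δ := fun x hx =>
    norm_fderiv_sub_le_of_iteratedFDeriv (h.contDiff_uS.of_le one_le_two)
      (cUS.of_le one_le_two) (aUS 1 one_le_two x hx)
  have dUD : ∀ x, ‖x‖ ≤ R → ‖fderiv ℝ UD x - fderiv ℝ uD x‖ ≤ δ := fun x hx =>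
    norm_fderiv_sub_le_of_iteratedFDeriv (h.contDiff_uD.of_le one_le_two)
      (cUD.of_le one_le_two) (aUD 1 one_le_two x hx)
  have dPS : ∀ x, ‖x‖ ≤ R → ‖fderiv ℝ PS x - fderiv ℝ pS x‖ ≤ δ := fun x hx =>
    norm_fderiv_sub_le_of_iteratedFDeriv h.contDiff_pS (by exact_mod_cast cPS)
      (aPS 1 le_rfl x hx)
  have dPD : ∀ x, ‖x‖ ≤ R → ‖fderiv ℝ PD x - fderiv ℝ pD x‖ ≤ δ := fun x hx =>
    norm_fderiv_sub_le_of_iteratedFDeriv h.contDiff_pD (by exact_mod_cast cPD)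
      (aPD 1 le_rfl x hx)
  have vUS : ∀ x, ‖x‖ ≤ R → ‖US x - uS x‖ ≤ δ := fun x hx =>
    norm_sub_le_of_iteratedFDeriv (aUS 0 zero_le_two x hx)
  have vUD : ∀ x, ‖x‖ ≤ R → ‖UD x - uD x‖ ≤ δ := fun x hx =>
    norm_sub_le_of_iteratedFDeriv (aUD 0 zero_le_two x hx)
  have vPS : ∀ x, ‖x‖ ≤ R → |PS x - pS x| ≤ δ := fun x hx =>
    norm_sub_le_of_iteratedFDeriv (aPS 0 zero_le_one x hx)
  have vPD : ∀ x, ‖x‖ ≤ R → |PD x - pD x| ≤ δ := fun x hx =>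
    norm_sub_le_of_iteratedFDeriv (aPD 0 zero_le_one x hx)
  have normal := D.ae_isOuterUnitNormal
  have memΓ : ∀ᵐ x ∂((μH[1] : Measure Plane).restrict D.Γ), x ∈ D.Γ :=
    ae_restrict_mem (isClosed_frontier.inter isClosed_frontier).measurableSet
  refine ⟨US, hUS, UD, hUD, PS, hPS, PD, hPD, D.loss_le (fun x hx => ?_) (fun x hx => ?_)
    (fun x hx => ?_) (fun x hx => ?_) (fun x hx => ?_) (fun x hx => ?_) ?_ ?_ ?_⟩
  · exact (D.norm_stokesRes_le h hν hx (norm_laplacian_sub_le_of_iteratedFDeriv h.contDiff_uS cUS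
      (aUS 2 le_rfl x (inS x hx))) (norm_gradient_sub_le (dPS x (inS x hx)))).trans
      (hδB _ (by linarith))
  · have := abs_divergence_sub_le (dUS x (inS x hx))
    rw [h.stokes_mass x hx, sub_zero] at this
    exact this.trans (hδB _ (by linarith))
  · have := vUS x (hR x (Or.inl hx.1.1))
    rw [h.stokes_boundary x hx, sub_zero] at this
    exact this.trans ((one_mul δ).symm.le.trans (hδB 1 (by linarith)))
  · have := abs_divergence_sub_le (dUD x (inD x hx))
    rw [h.darcy_mass x hx, abs_sub_comm] at this
    exact this.trans (hδB _ (by linarith))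
  · exact (D.norm_darcyRes_le h hk hx (hK x hx)
      ((hM x (by simpa using inD x hx)).trans (le_abs_self M)) hδ1 (vUD x (inD x hx))
      (norm_gradient_sub_le (dPD x (inD x hx)))).trans (hδB _ (by linarith))
  · have := vPD x (hR x (Or.inr hx.1.1))
    rw [h.darcy_boundary x hx, sub_zero] at this
    exact this.trans ((one_mul δ).symm.le.trans (hδB 1 (by linarith)))
  · filter_upwards [normal, memΓ] with x hn hx
    exact (D.abs_normalVelRes_le h hx hn (vUS x (inΓ x hx)) (vUD x (inΓ x hx))).trans
      (hδB _ (by linarith))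
  · filter_upwards [normal, memΓ] with x hn hx
    exact (D.abs_normalForceRes_le h hν hx hn (dUS x (inΓ x hx)) (vPS x (inΓ x hx))
      (vPD x (inΓ x hx))).trans (hδB _ (by linarith))
  · filter_upwards [normal, memΓ] with x hn hx
    exact (D.abs_bjsRes_le h hν hG hx hn (dUS x (inΓ x hx)) (vUS x (inΓ x hx))).trans
      (hδB _ (by linarith))

end Data

end CDNN

end

theorem theorem3p1 (D : CDNN.Data) :
    ∃ C : ℝ, 0 < C ∧
      ∀ (ν G : ℝ), 0 < ν → 0 < G →
      ∀ (φ ζ ψ γ : ℝ → ℝ), CDNN.IsActivation φ → CDNN.IsActivation ζ →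
        CDNN.IsActivation ψ → CDNN.IsActivation γ →
      ∀ (uS uD : CDNN.Plane → CDNN.Plane) (pS pD : CDNN.Plane → ℝ),
        D.IsClassicalSolution ν G uS uD pS pD →
      ∀ ε : ℝ, 0 < ε →
        ∃ US ∈ CDNN.vectorNets φ, ∃ UD ∈ CDNN.vectorNets ζ,
        ∃ PS ∈ CDNN.scalarNets ψ, ∃ PD ∈ CDNN.scalarNets γ,
          D.loss ν G US UD PS PD ≤ ENNReal.ofReal (C * ε ^ 2) := by
  -- The infimum of the loss is `0`, so every positive constant will do.
  refine ⟨1, one_pos, fun ν G hν hG φ ζ ψ γ hφ hζ hψ hγ uS uD pS pD h ε hε => ?_⟩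
  set W := D.mass.toReal with hW
  have hW0 : 0 ≤ W := ENNReal.toReal_nonneg
  obtain ⟨US, hUS, UD, hUD, PS, hPS, PD, hPD, hle⟩ :=
    D.exists_loss_le hν hG hφ hζ hψ hγ h (B := ε / (9 * W + 1)) (by positivity)
  refine ⟨US, hUS, UD, hUD, PS, hPS, PD, hPD, hle.trans ?_⟩
  rw [← ENNReal.ofReal_toReal D.mass_ne_top, ← hW, ← ENNReal.ofReal_mul (sq_nonneg _),
    show (9 : ℝ≥0∞) = ENNReal.ofReal 9 by simp, ← ENNReal.ofReal_mul (by norm_num)]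
  refine ENNReal.ofReal_le_ofReal ?_
  rw [div_pow, one_mul, div_mul_eq_mul_div, mul_div_assoc', div_le_iff₀ (by positivity)]
  nlinarith [sq_nonneg ε, mul_nonneg (sq_nonneg ε) hW0, mul_nonneg (sq_nonneg ε) (sq_nonneg W)]
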